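/- \textbf{Conventions.} Partitions are identified with their Ferrers diagrams; $h_s$ is the hook length of the box $s$; $\varepsilon_s=-1$ if $s$ lies strictly below the main diagonal and $\varepsilon_s=1$ otherwise. A $g$-core is a partition with no hook length divisible by $g$. A partition $\lambda$ with conjugate $\lambda'$ is doubled distinct ($\lambda\in\mathcal{DD}$) if $\lambda_i=\lambda_i'+1$ for all $1\le i\le d$, where $d$ is the side of its Durfee square; $\mathcal{DD}'$ is the set of conjugates of doubled distinct partitions. The word $(c_k)_{k\in\mathbb Z}$ of $\lambda$ encodes the steps of its border from South-West to North-East, with $0$ for a vertical and $1$ for a horizontal step, indexed so that $\#\{k\le -1: c_k=1\}=\#\{k\ge 0: c_k=0\}$; that is, $c_k=0$ if and only if $k=\lambda_i-i$ for some $i\ge 1$ (where $\lambda_i=0$ beyond the last part). The $g$-quotient $(\nu^{(0)},\dots,\nu^{(g-1)})$ of $\lambda$ consists of the partitions whose words are, up to a shift of the index, the subwords $(c_{gm+k})_{m\in\mathbb Z}$, $0\le k<g$. The $V_{g,t}$-coding ($t\le g$) of $\lambda$ is the vector $\mathbf v=(v_1>\dots>v_t)$ of the $t$ largest among the numbers $\beta_i=\max\{(k+1)g+i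 : c_{kg+i}=0\}$, $0\le i\le g-1$. Put $\alpha_i(\lambda)=\#\{s\in\lambda : h_s=g-i,\ \varepsilon_s=1\}$. For $g\ge 1$ let $\mathcal{DD}'^{1}_{g}$ be the set of $\lambda\in\mathcal{DD}'$ whose $g$-quotient is empty except for $\nu^{(g-1)}$, which consists of $m_1$ parts equal to $m_1-1$ for some integer $m_1\ge 1$. For even $g\ge 2$ let $\mathcal{DD}'^{2}_{g}$ be the set of $\lambda\in\mathcal{DD}'$ whose $g$-quotient is empty except for $\nu^{(g-1)}$, which consists of $m_1$ parts equal to $m_1-1$ for some $m_1\ge 1$, and $\nu^{(g/2-1)}$, which is an $m\times m$ square for some $m\ge 0$. \textbf{Theorem.} Let $t\ge 1$ be an integer, $F$ a field, and $\tau:\mathbb Z\to F^\times$ any function. In each case below $\mathbf v$ denotes the $V_{g,t}$-coding of the partition considered. (The numbers $r_i\pm r_j$ are always integers, and so are the $r_i$ in (3) and (4).) (1) Let $g=2t+1$, let $\omega\in\mathcal{DD}$ be a $g$-core, and $r_i=v_i-g/2$. Then $$|\omega|=\frac1g\sum_{i=1}^t r_i^2-\frac{(g-2)\lfloor g/2\rfloor}{12},$$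 $$\prod_{s\in\omega}\frac{\tau(h_s-\varepsilon_s g)}{\tau(h_s)}=\prod_{i=1}^{g-1}\left(\frac{\tau(-i)}{\tau(i)}\right)^{\alpha_i(\omega)}\prod_{1\le i<j\le t}\frac{\tau(r_i-r_j)}{\tau(j-i)}\,\frac{\tau(r_i+r_j)}{\tau(g-i-j)}.$$ (2) Let $g=2t-1$, $\lambda\in\mathcal{DD}'^{1}_{g}$, and $r_i=v_i-g/2+1$. Then $$|\lambda|=\frac1g\sum_{i=1}^t r_i^2-\frac{(g+2)(\lfloor g/2\rfloor+1)}{12},$$ $$\prod_{s\in\lambda}\frac{\tau(h_s-\varepsilon_s g)}{\tau(h_s)}=\prod_{i=1}^{g-1}\left(\frac{\tau(-i)}{\tau(i)}\right)^{\alpha_i(\lambda)}\prod_{1\le i<j\le t}\frac{\tau(r_i-r_j)}{\tau(j-i)}\,\frac{\tau(r_i+r_j)}{\tau(g+2-i-j)}.$$ (3) Let $g=2t$, $\lambda\in\mathcal{DD}'^{1}_{g}$, and $r_i=v_i-g/2+1$. Then $$|\lambda|=\frac1g\sum_{i=1}^t r_i^2-\frac{(g+1)(g/2+1)}{12},$$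 $$\prod_{s\in\lambda}\frac{\tau(h_s-\varepsilon_s g)}{\tau(h_s)}=\prod_{i=1}^{g-1}\left(\frac{\tau(-i)}{\tau(i)}\right)^{\alpha_i(\lambda)}\prod_{i=1}^t\frac{\tau(r_i)}{\tau(i)}\prod_{1\le i<j\le t}\frac{\tau(r_i-r_j)}{\tau(j-i)}\,\frac{\tau(r_i+r_j)}{\tau(g+2-i-j)}.$$ (4) Suppose $t\ge2$. Let $g=2t-2$, $\lambda\in\mathcal{DD}'^{2}_{g}$, and $r_i=v_i-g/2+1$. Then $$|\lambda|=\frac1g\sum_{i=1}^t r_i^2-\frac{(g/2+1)(g+1)}{12},$$ $$\prod_{s\in\lambda}\frac{\tau(h_s-\varepsilon_s g)}{\tau(h_s)}=\prod_{i=1}^{g-1}\left(\frac{\tau(-i)}{\tau(i)}\right)^{\alpha_i(\lambda)}\prod_{i=1}^t\frac{\tau(t-i)}{\tau(r_i)}\prod_{1\le i<j\le t}\frac{\tau(r_i-r_j)}{\tau(j-i)}\,\frac{\tau(r_i+r_j)}{\tau(g+2-i-j)}.$$ -/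

import Mathlib

open Finset

namespace YoungDiagram

/-- The hook length of the box `s` (rows and columns are numbered from `0`): the boxes strictly to
the right of `s`, those strictly below `s`, and `s` itself. -/
def hookLength (μ : YoungDiagram) (s : ℕ × ℕ) : ℕ :=
  (μ.rowLen s.1 - (s.2 + 1)) + (μ.colLen s.2 - (s.1 + 1)) + 1

/-- The sign of a box: `-1` strictly below the main diagonal, `1` otherwise. -/
def boxSign (s : ℕ × ℕ) : ℤ := if s.2 < s.1 then -1 else 1

/-- `μ` is a `g`-core: no hook length is divisible by `g`. -/
def IsCore (μ : YoungDiagram) (g : ℕ) : Prop :=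
  ∀ s ∈ μ.cells, ¬ g ∣ μ.hookLength s

/-- Doubled distinct partitions: `λ_i = λ'_i + 1` for every row `i` that meets the main diagonal,
that is, for the rows of the Durfee square. -/
def IsDoubledDistinct (μ : YoungDiagram) : Prop :=
  ∀ i : ℕ, (i, i) ∈ μ → μ.rowLen i = μ.colLen i + 1

/-- `α_i(μ)`: the number of boxes of sign `1` whose hook length is `g - i`. -/
def signedHookCount (μ : YoungDiagram) (g i : ℕ) : ℕ :=
  #{s ∈ μ.cells | (μ.hookLength s : ℤ) = (g : ℤ) - i ∧ boxSign s = 1}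

open Classical in
/-- The bi-infinite binary word of `μ`: the steps of the border of the diagram from the South-West
to the North-East, `0` for a vertical step and `1` for a horizontal one. The index of a step is
(column minus row) of its starting point, so that the main diagonal separates the letters of index
`-1` and `0`; the vertical step at the end of row `i` starts at the lattice point with column
`rowLen i` and row `i + 1`. -/
noncomputable def word (μ : YoungDiagram) (k : ℤ) : Fin 2 :=
  if ∃ i : ℕ, k = (μ.rowLen i : ℤ) - (i + 1) then 0 else 1

/-- `ν` is the `k`-th component of the `g`-quotient of `μ`: the subword of `μ` of the letters whose
index is `k` modulo `g` is, up to the choice of the origin, the word of `ν`. -/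
def IsQuotientComponent (μ : YoungDiagram) (g k : ℕ) (ν : YoungDiagram) : Prop :=
  ∃ n : ℤ, ∀ m : ℤ, ν.word m = μ.word ((m + n) * g + k)

/-- The rectangular diagram with `a` rows, all of length `b`. -/
def rectangle (a b : ℕ) : YoungDiagram where
  cells := range a ×ˢ range b
  isLowerSet := by
    intro x y hyx hx
    simp only [coe_product, coe_range, Set.mem_prod, Set.mem_Iio] at hx ⊢
    exact ⟨lt_of_le_of_lt hyx.1 hx.1, lt_of_le_of_lt hyx.2 hx.2⟩

/-- The conjugates of doubled distinct partitions whose `g`-quotient is empty except for its last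
component, which consists of `m₁` parts equal to `m₁ - 1`, for some `m₁ ≥ 1`. -/
def IsDDPrimeOne (μ : YoungDiagram) (g : ℕ) : Prop :=
  μ.transpose.IsDoubledDistinct ∧ ∃ m₁ : ℕ, 1 ≤ m₁ ∧
    ∀ k < g, μ.IsQuotientComponent g k (if k + 1 = g then rectangle m₁ (m₁ - 1) else ⊥)

/-- The conjugates of doubled distinct partitions whose `g`-quotient (`g` even) is empty except for
its last component, which consists of `m₁` parts equal to `m₁ - 1` for some `m₁ ≥ 1`, and its
component of index `g / 2 - 1`, which is an `m × m` square for some `m ≥ 0`. -/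
def IsDDPrimeTwo (μ : YoungDiagram) (g : ℕ) : Prop :=
  μ.transpose.IsDoubledDistinct ∧ ∃ m₁ m : ℕ, 1 ≤ m₁ ∧
    ∀ k < g, μ.IsQuotientComponent g k
      (if k + 1 = g then rectangle m₁ (m₁ - 1)
        else if 2 * (k + 1) = g then rectangle m m else ⊥)

/-- `v` is the `V_{g,t}`-coding of `μ`: with
`β_i = max {(k + 1) g + i | the letter of index k g + i is 0}` for `0 ≤ i < g` and `σ` the
bijection for which `β ∘ σ` is strictly decreasing, `v` lists the first `t` values of `β ∘ σ`
(the entries of `v` are numbered from `0`). -/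
def IsVCoding (μ : YoungDiagram) (g t : ℕ) (v : Fin t → ℤ) : Prop :=
  ∃ (h : t ≤ g) (β : Fin g → ℤ) (σ : Fin g ≃ Fin g),
    (∀ i : Fin g, IsGreatest
      {m : ℤ | ∃ k : ℤ, μ.word (k * g + (i : ℕ)) = 0 ∧ m = (k + 1) * g + (i : ℕ)} (β i)) ∧
    StrictAnti (fun j => β (σ j)) ∧
    ∀ j : Fin t, v j = β (σ (Fin.castLE h j))

/-- Every partition has exactly one `V_{g,t}`-coding. -/
theorem existsUnique_isVCoding (μ : YoungDiagram) (g t : ℕ) (hg : 1 ≤ g) (ht : t ≤ g) :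
    ∃! v : Fin t → ℤ, μ.IsVCoding g t v := by
  have hg' : (1 : ℤ) ≤ g := by exact_mod_cast hg
  have key : ∀ i : Fin g, ∃ b : ℤ, IsGreatest
      {m : ℤ | ∃ k : ℤ, μ.word (k * g + (i : ℕ)) = 0 ∧ m = (k + 1) * g + (i : ℕ)} b := by
    intro i
    have hbdd : BddAbove
        {m : ℤ | ∃ k : ℤ, μ.word (k * g + (i : ℕ)) = 0 ∧ m = (k + 1) * g + (i : ℕ)} := by
      refine ⟨(μ.rowLen 0 : ℤ) + g, ?_⟩
      rintro m ⟨k, hk, rfl⟩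
      unfold word at hk
      split_ifs at hk with hex
      · obtain ⟨r, hr⟩ := hex
        have := μ.rowLen_anti 0 r (Nat.zero_le _)
        nlinarith
      · simp at hk
    have hne : {m : ℤ | ∃ k : ℤ, μ.word (k * g + (i : ℕ)) = 0 ∧
        m = (k + 1) * g + (i : ℕ)}.Nonempty := by
      refine ⟨_, -(μ.colLen 0 : ℤ) - 1, ?_, rfl⟩
      have hi : ((i : ℕ) : ℤ) < g := by exact_mod_cast i.2
      have hneg : (-(μ.colLen 0 : ℤ) - 1) * g + ((i : ℕ) : ℤ) + 1 ≤ -(μ.colLen 0 : ℤ) := by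
        nlinarith [Int.natCast_nonneg (μ.colLen 0)]
      obtain ⟨r, hr⟩ := Int.eq_ofNat_of_zero_le
        (show (0 : ℤ) ≤ -((-(μ.colLen 0 : ℤ) - 1) * g + ((i : ℕ) : ℤ) + 1) by
          have := Int.natCast_nonneg (μ.colLen 0)
          linarith)
      have hr0 : μ.rowLen r = 0 := by
        by_contra hpos
        have h1 : (r, 0) ∈ μ := mem_iff_lt_rowLen.2 (Nat.pos_of_ne_zero hpos)
        have h2 := mem_iff_lt_colLen.1 h1
        have h3 : (r : ℤ) < μ.colLen 0 := by exact_mod_cast h2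
        linarith
      unfold word
      rw [if_pos]
      refine ⟨r, ?_⟩
      rw [hr0]
      push_cast
      linarith
    obtain ⟨B, hB⟩ := hbdd
    obtain ⟨b, hb, hb'⟩ := Int.exists_greatest_of_bdd ⟨B, fun z hz => hB hz⟩ hne
    exact ⟨b, hb, fun z hz => hb' z hz⟩
  choose β hβ using key
  have hinj : Function.Injective β := by
    intro i j hij
    obtain ⟨k, -, hk⟩ := (hβ i).1
    obtain ⟨l, -, hl⟩ := (hβ j).1
    have hmod : (((i : ℕ) : ℤ)) % g = (((j : ℕ) : ℤ)) % g := by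
      have h1 : ((i : ℕ) : ℤ) = ((j : ℕ) : ℤ) + (l - k) * g := by linarith
      rw [h1, Int.add_mul_emod_self_right]
    rw [Int.emod_eq_of_lt (by positivity) (by exact_mod_cast i.2),
      Int.emod_eq_of_lt (by positivity) (by exact_mod_cast j.2)] at hmod
    exact Fin.ext (by exact_mod_cast hmod)
  have hmono : Monotone ((fun i => -β i) ∘ Tuple.sort (fun i => -β i)) := Tuple.monotone_sort _
  have hanti : StrictAnti (fun j => β (Tuple.sort (fun i => -β i) j)) := by
    refine Antitone.strictAnti_of_injective (fun a b hab => ?_)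
      (hinj.comp (Tuple.sort (fun i => -β i)).injective)
    exact neg_le_neg_iff.1 (hmono hab)
  refine ⟨fun j => β (Tuple.sort (fun i => -β i) (Fin.castLE ht j)),
    ⟨ht, β, Tuple.sort (fun i => -β i), hβ, hanti, fun _ => rfl⟩, ?_⟩
  rintro w ⟨h', β', σ, hβ', hσ, hw⟩
  have hββ : β' = β := funext fun i => (hβ' i).unique (hβ i)
  subst hββ
  have heq := Tuple.unique_antitone (f := β') (σ := σ) (τ := Tuple.sort (fun i => -β' i))
    hσ.antitone hanti.antitone
  funext j
  rw [hw j]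
  exact congrFun heq (Fin.castLE h' j)

end YoungDiagram

/-!
Write `S` for the set of indices of the vertical border steps of the partition (its beads). Boxes
correspond to pairs `k ∉ S`, `l ∈ S`, `k < l`, with hook length `l - k`. For a doubled distinct
partition (`δ = 0`) or a conjugate of one (`δ = 1`), the shifted set `T = S + δ` is symmetric:
`x ∈ T` if and only if `-x ∉ T`, for `x ≠ 0`. So `T` is determined by its set `P` of positive
elements, a box has sign `1` if and only if `k + l ≥ 0` after the shift, and any sum over the boxes
of a function of hook length and sign is a quadratic expression in the indicator function of `P`
(`IsShiftSymmetric.sum_cells`). In particular the size is `∑ p ∈ P, 2 * p`.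

The factors `(τ (-i) / τ i) ^ α_i` account exactly for the boxes with a negative argument `h - g`,
and all other arguments in the formulas are non-negative. Hence `τ` may be replaced by the even
function `n ↦ τ |n|` and the powers dropped (`prod_cells_eq_signedHookCount_mul`). For an even
function `f`, written additively, the quadratic expression involves the second differences
`f (h - g) + f (h + g) - 2 f h` at `p + q` and `p - q`. The hypotheses on the `g`-quotient mean that
`P` is a union of chains of step `g`, along which these differences telescope. Prolonging one chain
by one bead therefore changes the sum over the boxes and the sum
`∑ (f (r_i - r_j) + f (r_i + r_j)) + ∑ ψ (r_i)` by the same amount (`sum_add_pairSum_chains`); the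
correction `ψ` is `0`, `0`, `f`, `-f` in the four families, according to how the self-conjugate
class of `g / 2` is treated (`sum_endStep_standard`). The contribution of the starting points of the
chains is that of the standard vector, because the starting points agree with the standard ones up
to reflection at `g / 2` (`IsChainEnds.image_foldUp`), which `f` does not see. Finally, the symmetry
of `T` pairs the ends of the chains of the classes `c` and `-c` as `r` and `-r`, so the chains that
meet `P` are among those of the `t` largest ends, which are the entries of the coding.
-/

namespace YoungDiagram

/-! ### Sums over unordered pairs -/

section PairSum

variable {A ι κ : Type*} [AddCommGroup A] [LinearOrder ι] [LinearOrder κ]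

/-- The sum of `K i j` over the pairs `i < j` of elements of `s`. For symmetric `K` this is a sum
over unordered pairs, which does not depend on the order. -/
def pairSum (K : ι → ι → A) (s : Finset ι) : A := ∑ i ∈ s, ∑ j ∈ s with i < j, K i j

lemma pairSum_eq_sum_lt {K : ι → ι → A} (hK : ∀ i j, K i j = K j i) (s : Finset ι) :
    pairSum K s = ∑ i ∈ s, ∑ j ∈ s with j < i, K i j := by
  simp only [pairSum, sum_filter]
  rw [sum_comm]
  simp only [hK]

lemma pairSum_insert {K : ι → ι → A} (hK : ∀ i j, K i j = K j i) {s : Finset ι} {x : ι}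
    (hx : x ∉ s) : pairSum K (insert x s) = pairSum K s + ∑ j ∈ s, K x j := by
  have h : ∑ j ∈ s, K x j =
      ∑ j ∈ s, ((if x < j then K x j else 0) + if j < x then K j x else 0) := by
    refine sum_congr rfl fun j hj => ?_
    rcases lt_trichotomy x j with h | rfl | h
    · simp [h, h.not_gt]
    · exact absurd hj hx
    · simp [h, h.not_gt, hK]
  simp only [pairSum, sum_filter]
  rw [sum_insert hx, sum_insert hx, h, sum_add_distrib]
  simp only [sum_insert hx, lt_irrefl, if_false, zero_add]
  rw [sum_add_distrib]
  abel

lemma pairSum_image {K : κ → κ → A} (hK : ∀ i j, K i j = K j i) (e : ι → κ) (s : Finset ι)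
    (he : Set.InjOn e s) : pairSum K (s.image e) = pairSum (fun i j => K (e i) (e j)) s := by
  induction s using Finset.induction_on with
  | empty => simp [pairSum]
  | insert x s hx ih =>
    have hinj : Set.InjOn e s := he.mono (by simp)
    have hx' : e x ∉ s.image e := by
      intro h
      obtain ⟨y, hy, hyx⟩ := mem_image.1 h
      exact hx (he (by simp [hy]) (by simp) hyx ▸ hy)
    rw [image_insert, pairSum_insert hK hx', pairSum_insert (fun i j => hK _ _) hx, ih hinj,
      sum_image hinj]

lemma pairSum_congr {K K' : ι → ι → A} {s : Finset ι} (h : ∀ i ∈ s, ∀ j ∈ s, K i j = K' i j) :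
    pairSum K s = pairSum K' s :=
  sum_congr rfl fun i hi => sum_congr rfl fun j hj => h i hi j (mem_filter.1 hj).1

end PairSum

/-! ### Beads arranged in chains -/

section Chains

variable {A ι : Type*} [AddCommGroup A]

/-- The second difference of `f` with step `g`. -/
def secondDiff (f : ℤ → A) (g h : ℤ) : A := (f (h - g) - f h) + (f (h + g) - f h)

/-- The interaction of two positive beads `p` and `q` in the sum over the boxes. -/
def beadKernel (f : ℤ → A) (g p q : ℤ) : A := secondDiff f g (p + q) - secondDiff f g (p - q)

/-- The interaction of two chain ends `a` and `b`: with `r = a - g / 2` and `r' = b - g / 2` it is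
`f (r - r') + f (r + r')`. -/
def endKernel (f : ℤ → A) (g a b : ℤ) : A := f (a - b) + f (a + b - g)

/-- The change of `endKernel f g x v` when `x` is replaced by `x + g`. -/
def endStep (f : ℤ → A) (g v x : ℤ) : A := f (x + v) - f (x + v - g) - f (x - v) + f (x - v + g)

lemma secondDiff_neg {f : ℤ → A} (hf : ∀ n, f (-n) = f n) (g h : ℤ) :
    secondDiff f g (-h) = secondDiff f g h := by
  unfold secondDiff
  rw [← hf (-h - g), ← hf (-h + g), hf h]
  ring_nf
  abel

lemma beadKernel_comm {f : ℤ → A} (hf : ∀ n, f (-n) = f n) (g p q : ℤ) :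
    beadKernel f g p q = beadKernel f g q p := by
  unfold beadKernel
  rw [← secondDiff_neg hf g (p - q), neg_sub, add_comm]

lemma endKernel_comm {f : ℤ → A} (hf : ∀ n, f (-n) = f n) (g a b : ℤ) :
    endKernel f g a b = endKernel f g b a := by
  unfold endKernel
  rw [← hf (a - b), neg_sub, add_comm a b]

lemma endKernel_reflect {f : ℤ → A} (hf : ∀ n, f (-n) = f n) (g a b : ℤ) :
    endKernel f g (g - a) b = endKernel f g a b := by
  unfold endKernel
  rw [← hf (g - a - b), ← hf (g - a + b - g), add_comm]
  congr 2 <;> ring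

lemma endKernel_add_step (f : ℤ → A) (g x v : ℤ) :
    endKernel f g (x + g) v = endKernel f g x v + endStep f g v x := by
  simp only [endKernel, endStep]
  rw [show x + g + v - g = x + v by ring, show x + g - v = x - v + g by ring]
  abel

/-- Summed over a chain of step `g`, the interaction with a bead `x` telescopes. -/
lemma sum_beadKernel_chain (f : ℤ → A) (g c x : ℤ) (m : ℕ) :
    ∑ k ∈ range m, beadKernel f g x (c + k * g) = endStep f g (c + m * g) x - endStep f g c x := by
  have := Finset.sum_range_sub (fun k : ℕ => endStep f g (c + k * g) x) m
  simp only [Nat.cast_zero, zero_mul, add_zero] at this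
  rw [← this]
  refine sum_congr rfl fun k _ => ?_
  simp only [beadKernel, endStep, secondDiff]
  push_cast
  ring_nf
  abel

/-- The union of the chains `c i, c i + g, …, c i + (m i - 1) g` for `i ∈ I`. -/
def chains (I : Finset ι) (c : ι → ℤ) (g : ℤ) (m : ι → ℕ) : Finset ℤ :=
  (I.sigma fun i => range (m i)).image fun s => c s.1 + s.2 * g

lemma mem_chains {I : Finset ι} {c : ι → ℤ} {g : ℤ} {m : ι → ℕ} {x : ℤ} :
    x ∈ chains I c g m ↔ ∃ i ∈ I, ∃ k < m i, c i + k * g = x := by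
  simp only [chains, mem_image, mem_sigma, mem_range, Sigma.exists]
  constructor
  · rintro ⟨i, k, ⟨hi, hk⟩, h⟩
    exact ⟨i, hi, k, hk, h⟩
  · rintro ⟨i, hi, k, hk, h⟩
    exact ⟨i, k, ⟨hi, hk⟩, h⟩

lemma sum_chains {B : Type*} [AddCommMonoid B] {I : Finset ι} {c : ι → ℤ} {g : ℤ} (hg : g ≠ 0)
    (hc : ∀ i ∈ I, ∀ j ∈ I, ∀ k l : ℤ, c i + k * g = c j + l * g → i = j) (m : ι → ℕ)
    (φ : ℤ → B) :
    ∑ x ∈ chains I c g m, φ x = ∑ i ∈ I, ∑ k ∈ range (m i), φ (c i + k * g) := by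
  unfold chains
  rw [sum_image, sum_sigma]
  rintro ⟨i, k⟩ hi ⟨j, l⟩ hj h
  simp only [mem_coe, mem_sigma] at hi hj h
  obtain rfl := hc i hi.1 j hj.1 k l h
  have : (k : ℤ) * g = l * g := by linarith
  have := mul_right_cancel₀ hg this
  simp only [Sigma.mk.injEq, heq_eq_eq, true_and]
  exact_mod_cast this

/-- Beads arranged in chains: a quadratic sum over the beads is a quadratic sum over the ends of the
chains. Prolonging one chain by a bead `x` changes both sides by the same amount, provided that the
one-bead term `G` satisfies the identity `hG`. -/
theorem sum_add_pairSum_chains [LinearOrder ι] {f : ℤ → A} (hf : ∀ n, f (-n) = f n) {g : ℤ}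
    (hg : 0 < g) {I : Finset ι} {c : ι → ℤ} (hpos : ∀ i ∈ I, 0 < c i)
    (hc : ∀ i ∈ I, ∀ j ∈ I, ∀ k l : ℤ, c i + k * g = c j + l * g → i = j)
    {G ψ : ℤ → A}
    (hG : ∀ x, 0 < x → G x - ∑ i ∈ I, endStep f g (c i) x + endStep f g x x = ψ (x + g) - ψ x)
    (m : ι → ℕ) :
    ∑ p ∈ chains I c g m, G p + pairSum (beadKernel f g) (chains I c g m) =
      (pairSum (fun i j => endKernel f g (c i + m i * g) (c j + m j * g)) I
        + ∑ i ∈ I, ψ (c i + m i * g)) -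
      (pairSum (fun i j => endKernel f g (c i) (c j)) I + ∑ i ∈ I, ψ (c i)) := by
  induction hN : ∑ i ∈ I, m i generalizing m with
  | zero =>
    have hm : ∀ i ∈ I, m i = 0 := by simpa using hN
    have h0 : chains I c g m = ∅ := by
      ext x
      simp only [mem_chains, notMem_empty, iff_false]
      rintro ⟨i, hi, k, hk, -⟩
      simp [hm i hi] at hk
    rw [h0, pairSum_congr (K := fun i j => endKernel f g (c i + m i * g) (c j + m j * g))
      (K' := fun i j => endKernel f g (c i) (c j)) (fun i hi j hj => by simp [hm i hi, hm j hj]),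
      sum_congr rfl (fun i hi => by rw [hm i hi] :
        ∀ i ∈ I, ψ (c i + m i * g) = ψ (c i + (0 : ℕ) * g))]
    simp [pairSum]
  | succ N ih =>
    obtain ⟨j, hj, hmj⟩ : ∃ j ∈ I, m j ≠ 0 := by
      by_contra! h
      rw [sum_congr rfl h] at hN
      simp at hN
    obtain ⟨n, hn⟩ := Nat.exists_eq_succ_of_ne_zero hmj
    set m' : ι → ℕ := Function.update m j n with hm'
    have hm'j : m' j = n := by simp [hm']
    have hm'i : ∀ i, i ≠ j → m' i = m i := fun i hi => by simp [hm', hi]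
    set x : ℤ := c j + n * g with hx
    have hxpos : 0 < x := by have := hpos j hj; positivity
    have hIj : insert j (I.erase j) = I := insert_erase hj
    have hnot : j ∉ I.erase j := notMem_erase j I
    have hN' : ∑ i ∈ I, m' i = N := by
      have h1 : ∑ i ∈ I.erase j, m' i = ∑ i ∈ I.erase j, m i :=
        sum_congr rfl fun i hi => hm'i i (ne_of_mem_erase hi)
      have h2 := add_sum_erase I m hj
      have h3 := add_sum_erase I m' hj
      omega
    have hins : chains I c g m = insert x (chains I c g m') := by
      ext y
      rw [mem_insert, mem_chains, mem_chains]
      constructor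
      · rintro ⟨i, hi, k, hk, rfl⟩
        by_cases hij : i = j
        · subst hij
          rcases eq_or_ne k n with rfl | hkn
          · exact Or.inl rfl
          · exact Or.inr ⟨i, hi, k, by omega, rfl⟩
        · exact Or.inr ⟨i, hi, k, by rwa [hm'i i hij], rfl⟩
      · rintro (rfl | ⟨i, hi, k, hk, rfl⟩)
        · exact ⟨j, hj, n, by omega, rfl⟩
        · refine ⟨i, hi, k, ?_, rfl⟩
          by_cases hij : i = j
          · subst hij; omega
          · rwa [hm'i i hij] at hk
    have hxnot : x ∉ chains I c g m' := by
      rw [mem_chains]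
      rintro ⟨i, hi, k, hk, h⟩
      obtain rfl := hc i hi j hj k n h
      have h1 : (k : ℤ) * g = n * g := by linarith
      have h2 := mul_right_cancel₀ hg.ne' h1
      omega
    -- In the chain `j` the end is `x` itself, which produces the term `endStep f g x x`.
    have hE : ∑ q ∈ chains I c g m', beadKernel f g x q =
        endStep f g x x + ∑ i ∈ I.erase j, endStep f g (c i + m i * g) x
          - ∑ i ∈ I, endStep f g (c i) x := by
      rw [sum_chains hg.ne' hc, sum_congr rfl fun i _ => sum_beadKernel_chain f g (c i) x (m' i),
        sum_sub_distrib, ← hIj, sum_insert hnot, hm'j, hIj]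
      congr 2
      exact sum_congr rfl fun i hi => by rw [hm'i i (ne_of_mem_erase hi)]
    have hxg : c j + m j * g = x + g := by rw [hn, hx]; push_cast; ring
    have hQ : pairSum (fun i j => endKernel f g (c i + m i * g) (c j + m j * g)) I =
        pairSum (fun i j => endKernel f g (c i + m' i * g) (c j + m' j * g)) I +
          ∑ i ∈ I.erase j, endStep f g (c i + m i * g) x := by
      have h1 : pairSum (fun i j => endKernel f g (c i + m' i * g) (c j + m' j * g)) (I.erase j) =
          pairSum (fun i j => endKernel f g (c i + m i * g) (c j + m j * g)) (I.erase j) :=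
        pairSum_congr fun a ha b hb => by
          rw [hm'i a (ne_of_mem_erase ha), hm'i b (ne_of_mem_erase hb)]
      have h2 : ∑ i ∈ I.erase j, endKernel f g (x + g) (c i + m i * g) =
          ∑ i ∈ I.erase j, endKernel f g x (c i + m' i * g) +
            ∑ i ∈ I.erase j, endStep f g (c i + m i * g) x := by
        rw [← sum_add_distrib]
        refine sum_congr rfl fun i hi => ?_
        rw [hm'i i (ne_of_mem_erase hi), endKernel_add_step]
      rw [← hIj, pairSum_insert (fun _ _ => endKernel_comm hf _ _ _) hnot,
        pairSum_insert (fun _ _ => endKernel_comm hf _ _ _) hnot, hIj, h1, hxg, hm'j, h2, add_assoc]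
    have hψ : ∑ i ∈ I, ψ (c i + m i * g) = ∑ i ∈ I, ψ (c i + m' i * g) + (ψ (x + g) - ψ x) := by
      have h1 : ∑ i ∈ I.erase j, ψ (c i + m' i * g) = ∑ i ∈ I.erase j, ψ (c i + m i * g) :=
        sum_congr rfl fun i hi => by rw [hm'i i (ne_of_mem_erase hi)]
      rw [← add_sum_erase I _ hj, ← add_sum_erase I _ hj, hxg, hm'j, h1]
      abel
    rw [hins, sum_insert hxnot, pairSum_insert (beadKernel_comm hf g) hxnot, hE, hQ, hψ,
      ← hG x hxpos]
    have := ih m' hN'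
    rw [add_assoc, ← add_assoc (∑ p ∈ chains I c g m', G p), this]
    abel

end Chains

/-! ### The one-bead term -/

section Residual

variable {A : Type*} [AddCommGroup A]

lemma sum_Ioo_zero_succ (φ : ℤ → A) (n : ℕ) :
    ∑ c ∈ Ioo (0 : ℤ) (n + 1), φ c = ∑ k ∈ range n, φ (k + 1) := by
  induction n with
  | zero => rw [show Ioo (0 : ℤ) ((0 : ℕ) + 1) = ∅ by ext; simp; omega]; simp
  | succ n ih =>
    rw [sum_range_succ, ← ih, add_comm (∑ c ∈ _, _)]
    have : Ioo (0 : ℤ) ((n + 1 : ℕ) + 1) = insert ((n : ℤ) + 1) (Ioo 0 ((n : ℤ) + 1)) := by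
      ext x; simp only [mem_Ioo, mem_insert]; push_cast; omega
    rw [this, sum_insert (by simp)]

/-- The second differences telescope, leaving two windows of length `g`. -/
lemma sum_secondDiff {f : ℤ → A} (hf : ∀ n, f (-n) = f n) {g : ℕ} (hg : 1 ≤ g) {x : ℤ}
    (hx : 0 < x) :
    ∑ h ∈ Ioo 0 x, secondDiff f g h =
      f 0 - f g + f x - f (x - g) + ∑ c ∈ Ioo (0 : ℤ) g, (f (x + c) - f (x - c)) := by
  obtain ⟨n, rfl⟩ := Nat.exists_eq_add_of_le' hg
  push_cast
  rw [sum_Ioo_zero_succ]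
  induction x, (show (1 : ℤ) ≤ x from hx) using Int.leInduction with
  | base =>
    have h := sum_range_sub (fun k : ℕ => f (k + 1) + f k) n
    have h' : ∀ k ∈ range n, f (1 + ((k : ℤ) + 1)) - f (1 - ((k : ℤ) + 1)) =
        f (((k + 1 : ℕ) : ℤ) + 1) + f ((k + 1 : ℕ) : ℤ) - (f ((k : ℤ) + 1) + f k) := by
      intro k _
      rw [← hf (1 - ((k : ℤ) + 1))]
      push_cast
      rw [show (1 : ℤ) + (k + 1) = k + 1 + 1 by ring, show -(1 - ((k : ℤ) + 1)) = k by ring]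
      abel
    rw [show Ioo (0 : ℤ) 1 = ∅ by ext; simp; omega, sum_congr rfl h', h,
      ← hf (1 - ((n : ℤ) + 1)), show -(1 - ((n : ℤ) + 1)) = n by ring]
    simp only [sum_empty, Nat.cast_zero, zero_add]
    abel
  | succ x hx' ih =>
    have hins : Ioo 0 (x + 1) = insert x (Ioo 0 x) := by
      ext y; simp only [mem_Ioo, mem_insert]; omega
    have h := sum_range_sub (fun k : ℕ => f (x + k + 1) + f (x - k)) n
    have h' : ∀ k ∈ range n, f (x + 1 + ((k : ℤ) + 1)) - f (x + 1 - ((k : ℤ) + 1)) =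
        (f (x + (k + 1 : ℕ) + 1) + f (x - (k + 1 : ℕ)) - (f (x + k + 1) + f (x - k))) +
          (f (x + ((k : ℤ) + 1)) - f (x - ((k : ℤ) + 1))) := by
      intro k _
      push_cast
      ring_nf
      abel
    rw [hins, sum_insert (by simp), ih (by omega), sum_congr rfl h', sum_add_distrib, h]
    simp only [secondDiff]
    push_cast
    ring_nf
    abel

lemma endStep_eq (f : ℤ → A) (g c x : ℤ) :
    endStep f g c x = (f (x + c) - f (x - c)) + (f (x + (g - c)) - f (x - (g - c))) := by
  simp only [endStep]
  ring_nf
  abel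

lemma endStep_reflect (f : ℤ → A) (g c x : ℤ) :
    endStep f g (g - c) x = endStep f g c x := by
  rw [endStep_eq, endStep_eq, sub_sub_cancel, add_comm]

/-- Each class `c > g / 2` contributes the terms of `c` and of `g - c`; only the self-conjugate
class is missed. -/
lemma sum_endStep_upper_half (f : ℤ → A) (g x : ℤ) :
    ∑ c ∈ Ioo 0 g with g < 2 * c, endStep f g c x =
      ∑ c ∈ Ioo 0 g, (f (x + c) - f (x - c)) -
        ∑ c ∈ Ioo 0 g with 2 * c = g, (f (x + c) - f (x - c)) := by
  set H : ℤ → A := fun c => f (x + c) - f (x - c) with hH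
  have h1 : ∑ c ∈ Ioo 0 g with g < 2 * c, H (g - c) = ∑ c ∈ Ioo 0 g with 2 * c < g, H c := by
    refine sum_bij' (fun c _ => g - c) (fun c _ => g - c) ?_ ?_ ?_ ?_ ?_
    all_goals simp only [mem_filter, mem_Ioo]
    all_goals intros
    all_goals first | omega | rfl | trivial
  have h2 : ∀ c ∈ Ioo 0 g, H c = (if g < 2 * c then H c else 0) + (if 2 * c < g then H c else 0) +
      (if 2 * c = g then H c else 0) := by
    intro c _
    rcases lt_trichotomy (2 * c) g with h | h | h
    · simp [h, h.not_gt, h.ne]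
    · simp [h]
    · simp [h, h.not_gt, h.ne']
  rw [sum_congr rfl h2, sum_add_distrib, sum_add_distrib, ← sum_filter, ← sum_filter, ← sum_filter,
    ← h1, add_sub_cancel_right, ← sum_add_distrib]
  exact sum_congr rfl fun c _ => endStep_eq f g c x

/-- The one-bead term: the boxes attached to a bead `x`, apart from the interactions with the other
beads. The parameter `δ` is `0` for doubled distinct partitions and `1` for their conjugates. -/
noncomputable def beadTerm (f : ℤ → A) (g : ℤ) (δ : ℕ) (x : ℤ) : A :=
  ∑ k ∈ Ioo 0 x, secondDiff f g (x - k) + (f (2 * x - g) - f (2 * x)) +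
    if δ = 0 then f (x - g) - f x else f (x + g) - f x

/-- The hypothesis on the one-bead term in `sum_add_pairSum_chains`, reduced to a sum over the
starting points of the chains. -/
lemma beadTerm_identity {f : ℤ → A} (hf : ∀ n, f (-n) = f n) {g : ℕ} (hg : 1 ≤ g) (δ : ℕ)
    {x : ℤ} (hx : 0 < x) (Δ : A) {S : Finset ℤ}
    (hS : ∑ c ∈ S, endStep f g c x = ∑ c ∈ Ioo (0 : ℤ) g, (f (x + c) - f (x - c)) +
      (if δ = 0 then 0 else f (x + g) - f (x - g)) - Δ) :
    beadTerm f g δ x - ∑ c ∈ S, endStep f g c x + endStep f g x x = Δ := by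
  have h : ∑ k ∈ Ioo 0 x, secondDiff f g (x - k) = ∑ k ∈ Ioo 0 x, secondDiff f g k := by
    refine sum_bij' (fun c _ => x - c) (fun c _ => x - c) ?_ ?_ ?_ ?_ ?_
    all_goals simp only [mem_Ioo]
    all_goals intros
    all_goals first | omega | rfl | trivial
  rw [hS, beadTerm, h, sum_secondDiff hf hg hx, endStep, sub_self, zero_add, ← two_mul]
  split_ifs <;> abel

end Residual

/-! ### Beads of a partition and their symmetry -/

section Beads

/-- The position of the vertical border step at the end of row `i`. -/
def rowBead (μ : YoungDiagram) (i : ℕ) : ℤ := μ.rowLen i - (i + 1)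

/-- The position of the horizontal border step at the end of column `j`. -/
def colBead (μ : YoungDiagram) (j : ℕ) : ℤ := j - μ.colLen j

lemma hookLength_eq (μ : YoungDiagram) {s : ℕ × ℕ} (hs : s ∈ μ) :
    (μ.hookLength s : ℤ) = μ.rowBead s.1 - μ.colBead s.2 := by
  have h1 := mem_iff_lt_rowLen.1 (show (s.1, s.2) ∈ μ from hs)
  have h2 := mem_iff_lt_colLen.1 (show (s.1, s.2) ∈ μ from hs)
  unfold hookLength rowBead colBead
  omega

lemma mem_iff_colBead_lt (μ : YoungDiagram) (i j : ℕ) :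
    (i, j) ∈ μ ↔ μ.colBead j < μ.rowBead i := by
  have h1 : (i, j) ∈ μ ↔ _ := mem_iff_lt_rowLen
  have h2 : (i, j) ∈ μ ↔ _ := mem_iff_lt_colLen
  unfold rowBead colBead
  by_cases h : (i, j) ∈ μ
  · have := h1.1 h; have := h2.1 h
    simp only [h, true_iff]; omega
  · have h3 : ¬ _ := fun h' => h (h1.2 h')
    have h4 : ¬ _ := fun h' => h (h2.2 h')
    simp only [h, false_iff]; omega

lemma rowBead_strictAnti (μ : YoungDiagram) : StrictAnti μ.rowBead := fun i j h => by
  have := μ.rowLen_anti i j h.le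
  unfold rowBead; omega

lemma colBead_strictMono (μ : YoungDiagram) : StrictMono μ.colBead := fun i j h => by
  have := μ.colLen_anti i j h.le
  unfold colBead; omega

lemma rowBead_ne_colBead (μ : YoungDiagram) (i j : ℕ) : μ.rowBead i ≠ μ.colBead j := by
  have h1 : (i, j) ∈ μ ↔ _ := mem_iff_lt_rowLen
  have h2 : (i, j) ∈ μ ↔ _ := mem_iff_lt_colLen
  have h3 := h1.symm.trans h2
  unfold rowBead colBead
  omega

/-- Every border step is vertical or horizontal: with `i` the first row whose bead is at most `z`,
either that bead is `z`, or `z` belongs to column `z + i`, whose length is `i`. -/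
lemma exists_bead (μ : YoungDiagram) (z : ℤ) :
    (∃ i, z = μ.rowBead i) ∨ ∃ j, z = μ.colBead j := by
  classical
  have hex : ∃ i, μ.rowBead i ≤ z := by
    refine ⟨(μ.rowLen 0 + z.natAbs), ?_⟩
    have := μ.rowLen_anti 0 (μ.rowLen 0 + z.natAbs) (Nat.zero_le _)
    unfold rowBead; omega
  set i := Nat.find hex with hi
  have h1 : μ.rowBead i ≤ z := Nat.find_spec hex
  rcases h1.eq_or_lt with h | h
  · exact Or.inl ⟨i, h.symm⟩
  right
  have hj : 0 ≤ z + i := by unfold rowBead at h; omega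
  refine ⟨(z + i).toNat, ?_⟩
  have hnot : (i, (z + i).toNat) ∉ μ := fun h' => by
    have := mem_iff_lt_rowLen.1 h'
    unfold rowBead at h; omega
  have hle : μ.colLen (z + i).toNat ≤ i := by
    by_contra h'
    exact hnot (mem_iff_lt_colLen.2 (by omega))
  have hge : i ≤ μ.colLen (z + i).toNat := by
    rcases Nat.eq_zero_or_pos i with h0 | h0
    · omega
    have h2 : ¬ μ.rowBead (i - 1) ≤ z := Nat.find_min hex (by omega)
    have : (i - 1, (z + i).toNat) ∈ μ := mem_iff_lt_rowLen.2 (by unfold rowBead at h2; omega)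
    have := mem_iff_lt_colLen.1 this
    omega
  unfold colBead; omega

lemma word_eq_zero_iff (μ : YoungDiagram) (k : ℤ) : μ.word k = 0 ↔ ∃ i, k = μ.rowBead i := by
  unfold word rowBead
  split_ifs with h <;> simp [h]

/-- The two symmetry types: `δ = 0` for doubled distinct partitions, `δ = 1` for their
conjugates. -/
def IsShiftSymmetric (μ : YoungDiagram) (δ : ℕ) : Prop :=
  δ ≤ 1 ∧ ∀ i, (i, i) ∈ μ → (μ.colLen i : ℤ) = μ.rowLen i + 2 * δ - 1

lemma IsDoubledDistinct.isShiftSymmetric {μ : YoungDiagram} (h : μ.IsDoubledDistinct) :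
    μ.IsShiftSymmetric 0 :=
  ⟨by omega, fun i hi => by have := h i hi; push_cast; omega⟩

lemma isShiftSymmetric_one_of_transpose {μ : YoungDiagram} (h : μ.transpose.IsDoubledDistinct) :
    μ.IsShiftSymmetric 1 :=
  ⟨le_rfl, fun i hi => by
    have := h i (by simpa [mem_transpose] using hi)
    rw [rowLen_transpose, colLen_transpose] at this
    push_cast; omega⟩

/-- The rows that meet the main diagonal. -/
def diagRows (μ : YoungDiagram) : Finset ℕ := {i ∈ range (μ.colLen 0) | (i, i) ∈ μ}

lemma mem_diagRows {μ : YoungDiagram} {i : ℕ} : i ∈ μ.diagRows ↔ (i, i) ∈ μ := by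
  simp only [diagRows, mem_filter, mem_range, and_iff_right_iff_imp]
  intro h
  exact mem_iff_lt_colLen.1 (μ.up_left_mem le_rfl (Nat.zero_le i) h)

/-- The positive beads of `μ`, after a shift by `δ`. -/
def posBeads (μ : YoungDiagram) (δ : ℕ) : Finset ℤ := μ.diagRows.image fun i => μ.rowBead i + δ

variable {μ : YoungDiagram} {δ : ℕ}

namespace IsShiftSymmetric

lemma colBead_eq (h : μ.IsShiftSymmetric δ) {i : ℕ} (hi : (i, i) ∈ μ) :
    μ.colBead i + δ = -(μ.rowBead i + δ) := by
  have := h.2 i hi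
  unfold colBead rowBead; omega

lemma rowBead_pos (h : μ.IsShiftSymmetric δ) {i : ℕ} (hi : (i, i) ∈ μ) :
    0 < μ.rowBead i + δ := by
  have h1 := h.2 i hi
  have h2 := mem_iff_lt_colLen.1 hi
  have h3 := mem_iff_lt_rowLen.1 hi
  have := h.1
  unfold rowBead; omega

lemma rowBead_nonpos (h : μ.IsShiftSymmetric δ) {i : ℕ} (hi : (i, i) ∉ μ) :
    μ.rowBead i + δ ≤ 0 ∧ (δ = 0 → μ.rowBead i + δ ≠ 0) := by
  have h3 : ¬ _ := fun h' => hi (mem_iff_lt_rowLen.2 h')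
  have := h.1
  unfold rowBead; omega

lemma colBead_nonneg (h : μ.IsShiftSymmetric δ) {i : ℕ} (hi : (i, i) ∉ μ) :
    0 ≤ μ.colBead i + δ ∧ (δ = 1 → μ.colBead i + δ ≠ 0) := by
  have h3 : ¬ _ := fun h' => hi (mem_iff_lt_colLen.2 h')
  have := h.1
  unfold colBead; omega

end IsShiftSymmetric

/-- The shifted bead set of `μ`. -/
def Bead (μ : YoungDiagram) (δ : ℕ) (x : ℤ) : Prop := ∃ i, x = μ.rowBead i + δ

lemma bead_iff_word {x : ℤ} : μ.Bead δ x ↔ μ.word (x - δ) = 0 := by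
  rw [word_eq_zero_iff, Bead]
  exact exists_congr fun i => sub_eq_iff_eq_add.symm

lemma not_bead_iff {x : ℤ} : ¬ μ.Bead δ x ↔ ∃ j, x = μ.colBead j + δ := by
  constructor
  · intro h
    rcases μ.exists_bead (x - δ) with ⟨i, hi⟩ | ⟨j, hj⟩
    · exact absurd ⟨i, by omega⟩ h
    · exact ⟨j, by omega⟩
  · rintro ⟨j, rfl⟩ ⟨i, hi⟩
    exact μ.rowBead_ne_colBead i j (by omega)

namespace IsShiftSymmetric

lemma mem_posBeads (h : μ.IsShiftSymmetric δ) {x : ℤ} :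
    x ∈ μ.posBeads δ ↔ 0 < x ∧ μ.Bead δ x := by
  simp only [posBeads, mem_image, mem_diagRows]
  constructor
  · rintro ⟨i, hi, rfl⟩
    exact ⟨h.rowBead_pos hi, i, rfl⟩
  · rintro ⟨hx, i, rfl⟩
    refine ⟨i, ?_, rfl⟩
    by_contra hi
    have := (h.rowBead_nonpos hi).1
    omega

lemma bead_neg_iff (h : μ.IsShiftSymmetric δ) {x : ℤ} (hx : x ≠ 0) :
    μ.Bead δ (-x) ↔ ¬ μ.Bead δ x := by
  have key : ∀ y : ℤ, 0 < y → (μ.Bead δ y ↔ ¬ μ.Bead δ (-y)) := by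
    intro y hy
    rw [not_bead_iff]
    constructor
    · intro hb
      obtain ⟨i, hi, rfl⟩ := mem_image.1 (h.mem_posBeads.2 ⟨hy, hb⟩)
      exact ⟨i, by rw [h.colBead_eq (mem_diagRows.1 hi)]⟩
    · rintro ⟨j, hj⟩
      have hjj : (j, j) ∈ μ := by
        by_contra hjj
        have := (h.colBead_nonneg hjj).1
        omega
      exact ⟨j, by have := h.colBead_eq hjj; omega⟩
  rcases lt_or_gt_of_ne hx with h' | h'
  · have := key (-x) (by omega)
    rwa [neg_neg] at this
  · have := key x h'
    tauto

lemma bead_zero_iff (h : μ.IsShiftSymmetric δ) : μ.Bead δ 0 ↔ δ = 1 := by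
  have hδ := h.1
  constructor
  · rintro ⟨i, hi⟩
    by_cases hii : (i, i) ∈ μ
    · have := h.rowBead_pos hii; omega
    · have := (h.rowBead_nonpos hii).2; omega
  · intro h1
    by_contra h0
    obtain ⟨j, hj⟩ := not_bead_iff.1 h0
    by_cases hjj : (j, j) ∈ μ
    · have := h.rowBead_pos hjj; have := h.colBead_eq hjj; omega
    · have := (h.colBead_nonneg hjj).2; omega

end IsShiftSymmetric

end Beads

/-! ### Sums over boxes as sums over positive beads -/

section BoxSum

variable {A : Type*} [AddCommGroup A] {μ : YoungDiagram} {δ : ℕ}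

/-- Every box on or above the diagonal lies in a row, every box below it in a column, that meets the
diagonal. -/
lemma sum_cells_eq_sum_diagRows (μ : YoungDiagram) (φ ψ : ℕ → ℕ → A) :
    ∑ s ∈ μ.cells, (if s.2 < s.1 then ψ s.1 s.2 else φ s.1 s.2) =
      ∑ i ∈ μ.diagRows, (∑ j ∈ Ico i (μ.rowLen i), φ i j + ∑ j ∈ Ioo i (μ.colLen i), ψ j i) := by
  rw [sum_ite, sum_add_distrib, add_comm]
  congr 1
  · refine sum_finset_product' _ _ _ fun ⟨i, j⟩ => ?_
    simp only [mem_filter, mem_cells, mem_diagRows, mem_Ico, mem_iff_lt_rowLen, not_lt]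
    constructor
    · rintro ⟨h1, h2⟩; exact ⟨by omega, h2, h1⟩
    · rintro ⟨-, h2, h1⟩; exact ⟨h1, h2⟩
  · refine sum_finset_product_right' _ _ _ fun ⟨i, j⟩ => ?_
    simp only [mem_filter, mem_cells, mem_diagRows, mem_Ioo, mem_iff_lt_colLen]
    constructor
    · rintro ⟨h1, h2⟩; exact ⟨by omega, h2, h1⟩
    · rintro ⟨-, h2, h1⟩; exact ⟨h1, h2⟩

lemma sum_Ioo_symm (φ : ℤ → A) {p : ℤ} (hp : 0 < p) :
    ∑ k ∈ Ioo (-p) p, φ k = φ 0 + ∑ k ∈ Ioo 0 p, (φ k + φ (-k)) := by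
  have h1 : Ioo (-p) p = insert 0 (Ioo 0 p ∪ (Ioo 0 p).image fun k => -k) := by
    ext x
    simp only [mem_Ioo, mem_insert, mem_union, mem_image]
    constructor
    · intro h
      rcases lt_trichotomy x 0 with h0 | h0 | h0
      · exact Or.inr (Or.inr ⟨-x, by omega, by omega⟩)
      · exact Or.inl h0
      · exact Or.inr (Or.inl (by omega))
    · rintro (h | h | ⟨y, h, rfl⟩) <;> omega
  have hd : Disjoint (Ioo 0 p) ((Ioo 0 p).image fun k => -k) := by
    rw [disjoint_left]
    simp only [mem_Ioo, mem_image]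
    rintro x hx ⟨y, hy, rfl⟩
    omega
  rw [h1, sum_insert, sum_union hd, sum_image (fun a _ b _ h => neg_injective h), sum_add_distrib]
  simp only [mem_Ioo, mem_union, mem_image]
  rintro (h | ⟨y, h, h'⟩) <;> omega

open Classical in
lemma IsShiftSymmetric.sum_row (h : μ.IsShiftSymmetric δ) {i : ℕ} (hi : (i, i) ∈ μ) (a : ℤ → A) :
    ∑ j ∈ Ico i (μ.rowLen i), a (μ.rowBead i - μ.colBead j) =
      ∑ k ∈ Ico (-(μ.rowBead i + δ)) (μ.rowBead i + δ) with ¬ μ.Bead δ k,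
        a (μ.rowBead i + δ - k) := by
  have himg : {k ∈ Ico (-(μ.rowBead i + δ)) (μ.rowBead i + δ) | ¬ μ.Bead δ k} =
      (Ico i (μ.rowLen i)).image fun j => μ.colBead j + δ := by
    ext x
    simp only [mem_filter, mem_Ico, mem_image, not_bead_iff, ← h.colBead_eq hi]
    constructor
    · rintro ⟨⟨h1, h2⟩, j, rfl⟩
      refine ⟨j, ⟨?_, ?_⟩, rfl⟩
      · exact μ.colBead_strictMono.le_iff_le.1 (by omega)
      · exact mem_iff_lt_rowLen.1 ((mem_iff_colBead_lt _ _ _).2 (by omega))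
    · rintro ⟨j, ⟨h1, h2⟩, rfl⟩
      have h3 := (mem_iff_colBead_lt _ _ _).1 (mem_iff_lt_rowLen.2 h2)
      have h4 := μ.colBead_strictMono.le_iff_le.2 h1
      exact ⟨⟨by omega, by omega⟩, j, rfl⟩
  rw [himg, sum_image fun x _ y _ hxy => μ.colBead_strictMono.injective (add_right_cancel hxy)]
  exact sum_congr rfl fun j _ => by rw [add_sub_add_right_eq_sub]

open Classical in
lemma IsShiftSymmetric.sum_col (h : μ.IsShiftSymmetric δ) {i : ℕ} (hi : (i, i) ∈ μ) (b : ℤ → A) :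
    ∑ j ∈ Ioo i (μ.colLen i), b (μ.rowBead j - μ.colBead i) =
      ∑ k ∈ Ioo (-(μ.rowBead i + δ)) (μ.rowBead i + δ) with μ.Bead δ k,
        b (μ.rowBead i + δ + k) := by
  have hci := h.colBead_eq hi
  have himg : {k ∈ Ioo (-(μ.rowBead i + δ)) (μ.rowBead i + δ) | μ.Bead δ k} =
      (Ioo i (μ.colLen i)).image fun j => μ.rowBead j + δ := by
    ext x
    simp only [mem_filter, mem_Ioo, mem_image, Bead, ← hci]
    constructor
    · rintro ⟨⟨h1, h2⟩, j, rfl⟩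
      refine ⟨j, ⟨?_, ?_⟩, rfl⟩
      · exact μ.rowBead_strictAnti.lt_iff_gt.1 (by omega)
      · exact mem_iff_lt_colLen.1 ((mem_iff_colBead_lt _ _ _).2 (by omega))
    · rintro ⟨j, ⟨h1, h2⟩, rfl⟩
      have h3 := (mem_iff_colBead_lt _ _ _).1 (mem_iff_lt_colLen.2 h2)
      have h4 := μ.rowBead_strictAnti h1
      exact ⟨⟨by omega, by omega⟩, j, rfl⟩
  rw [himg, sum_image fun x _ y _ hxy => μ.rowBead_strictAnti.injective (add_right_cancel hxy)]
  exact sum_congr rfl fun j _ => by congr 1; omega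

/-- A sum over the boxes of a (conjugate) doubled distinct partition, as a quadratic expression in
the indicator function of its set of positive beads. -/
theorem IsShiftSymmetric.sum_cells (h : μ.IsShiftSymmetric δ) (a b : ℤ → A)
    (hab : ∀ n, a (-n) + b (-n) = a n + b n) :
    ∑ s ∈ μ.cells, (if s.2 < s.1 then b (μ.hookLength s) else a (μ.hookLength s)) =
      ∑ p ∈ μ.posBeads δ, (∑ k ∈ Ioo 0 p, (a (p - k) + b (p - k)) + a (2 * p) +
        if δ = 0 then a p else b p) +
      pairSum (fun p q => (a (p + q) + b (p + q)) - (a (p - q) + b (p - q))) (μ.posBeads δ) := by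
  classical
  have h1 : ∀ s ∈ μ.cells, (if s.2 < s.1 then b (μ.hookLength s) else a (μ.hookLength s)) =
      if s.2 < s.1 then b (μ.rowBead s.1 - μ.colBead s.2)
        else a (μ.rowBead s.1 - μ.colBead s.2) := by
    intro s hs
    rw [μ.hookLength_eq ((mem_cells s).1 hs)]
  rw [sum_congr rfl h1, sum_cells_eq_sum_diagRows μ
      (fun i j => a (μ.rowBead i - μ.colBead j)) (fun i j => b (μ.rowBead i - μ.colBead j)),
    pairSum_eq_sum_lt
      (fun p q => by rw [← neg_sub p q, hab (p - q), add_comm p q]), ← sum_add_distrib]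
  conv_rhs => rw [posBeads, sum_image fun x _ y _ hxy =>
    μ.rowBead_strictAnti.injective (add_right_cancel hxy)]
  refine sum_congr rfl fun i hi => ?_
  have hii := mem_diagRows.1 hi
  rw [h.sum_row hii, h.sum_col hii, ← posBeads]
  have hp := h.rowBead_pos hii
  set p := μ.rowBead i + δ with hpdef
  have hpB : μ.Bead δ p := ⟨i, rfl⟩
  have hfilter : {q ∈ μ.posBeads δ | q < p} = {k ∈ Ioo 0 p | μ.Bead δ k} := by
    ext x
    simp only [mem_filter, mem_Ioo, h.mem_posBeads]
    tauto
  have hIco : Ico (-p) p = insert (-p) (Ioo (-p) p) := by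
    ext x; simp only [mem_Ico, mem_insert, mem_Ioo]; omega
  rw [hfilter, sum_filter, sum_filter, sum_filter, hIco, sum_insert (by simp), sum_Ioo_symm _ hp,
    sum_Ioo_symm _ hp]
  have hpn : ¬ μ.Bead δ (-p) := by rw [h.bead_neg_iff hp.ne']; simpa using hpB
  rw [if_pos hpn, show p - -p = 2 * p by ring, sub_zero, add_zero]
  have hz : (if ¬ μ.Bead δ 0 then a p else 0) + (if μ.Bead δ 0 then b p else 0) =
      if δ = 0 then a p else b p := by
    rw [h.bead_zero_iff]
    have := h.1
    rcases Nat.eq_zero_or_pos δ with h0 | h0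
    · simp [h0]
    · simp [show δ = 1 by omega]
  have hs : ∑ k ∈ Ioo 0 p, ((if ¬ μ.Bead δ k then a (p - k) else 0) +
        (if ¬ μ.Bead δ (-k) then a (p - -k) else 0)) +
      ∑ k ∈ Ioo 0 p, ((if μ.Bead δ k then b (p + k) else 0) +
        (if μ.Bead δ (-k) then b (p + -k) else 0)) =
      ∑ k ∈ Ioo 0 p, (a (p - k) + b (p - k)) + ∑ k ∈ Ioo 0 p, (if μ.Bead δ k then
        (a (p + k) + b (p + k)) - (a (p - k) + b (p - k)) else 0) := by
    rw [← sum_add_distrib, ← sum_add_distrib]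
    refine sum_congr rfl fun k hk => ?_
    have hk0 : k ≠ 0 := (mem_Ioo.1 hk).1.ne'
    rw [h.bead_neg_iff hk0, sub_neg_eq_add, ← sub_eq_add_neg]
    by_cases hB : μ.Bead δ k
    · simp [hB]
    · simp [hB]
  rw [← hz, show ∀ x1 x2 x3 x4 x5 : A, x1 + (x2 + x3) + (x4 + x5) = x1 + (x2 + x4) + (x3 + x5) by
    intros; abel, hs]
  abel

/-- A (conjugate) doubled distinct partition has twice the size of its set of positive beads. -/
lemma IsShiftSymmetric.card_eq (h : μ.IsShiftSymmetric δ) :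
    (μ.card : ℤ) = ∑ p ∈ μ.posBeads δ, 2 * p := by
  have := h.sum_cells (fun _ => (1 : ℤ)) (fun _ => 1) (fun _ => rfl)
  simp only [ite_self, sum_const, Int.card_Ioo, pairSum, sub_self, nsmul_zero] at this
  rw [YoungDiagram.card, ← mul_one (μ.cells.card : ℤ), ← nsmul_eq_mul, this]
  simp only [nsmul_eq_mul, add_zero]
  refine sum_congr rfl fun p hp => ?_
  have := (h.mem_posBeads.1 hp).1
  rw [sub_zero, Int.toNat_of_nonneg (by omega)]
  ring

end BoxSum

/-! ### The largest chain ends -/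

section ChainEnds

variable {A : Type*} [AddCommGroup A] {μ : YoungDiagram} {δ g η t : ℕ} {b : Fin g → ℤ}

/-- The positive beads of `μ` in the residue class of `i + δ` modulo `g` are those of the class
that are less than `b i`, and the ends `b i` are arranged symmetrically with respect to `g / 2`. If
`η = 1`, the class of `g / 2` has an end at least `g / 2` and counts among the chains; otherwise its
end is `g / 2`. -/
structure IsChainEnds (μ : YoungDiagram) (δ η : ℕ) (b : Fin g → ℤ) : Prop where
  modEq : ∀ i : Fin g, ∃ k : ℤ, b i = (i : ℕ) + δ + k * g
  bead_iff : ∀ (i : Fin g) (k : ℤ), 0 < ((i : ℕ) : ℤ) + δ + k * g →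
    (μ.Bead δ ((i : ℕ) + δ + k * g) ↔ ((i : ℕ) : ℤ) + δ + k * g + g ≤ b i)
  add_eq : ∀ i j : Fin g, ((i : ℕ) : ℤ) + δ + ((j : ℕ) + δ) = g → 2 * (((i : ℕ) : ℤ) + δ) ≠ g →
    b i + b j = g
  zero_class : ∀ i : Fin g, ((i : ℕ) : ℤ) + δ = 0 → b i = 0
  top_class : ∀ i : Fin g, ((i : ℕ) : ℤ) + δ = g → g ≤ b i
  half_class : ∀ i : Fin g, 2 * (((i : ℕ) : ℤ) + δ) = g →
    if η = 1 then (g : ℤ) ≤ 2 * b i else 2 * b i = g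

/-- The classes whose end is greater than `g / 2` (or equal to it, if `η = 1`). -/
def upperClasses (η : ℕ) (b : Fin g → ℤ) : Finset (Fin g) := {i | (g : ℤ) < 2 * b i + η}

/-- The reflection at `g / 2` of the lower half onto the upper half. -/
def foldUp (g : ℕ) (c : ℤ) : ℤ := if 2 * c < g then g - c else c

lemma apply_foldUp {B : Type*} {φ : ℤ → B} (hφ : ∀ c, φ (g - c) = φ c) (c : ℤ) :
    φ (foldUp g c) = φ c := by
  unfold foldUp
  split_ifs
  · exact hφ c
  · rfl

/-- The number of beads in the chain of the class `i`. -/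
def chainLength (δ : ℕ) (b : Fin g → ℤ) (i : Fin g) : ℕ :=
  ((b i - ((i : ℕ) + δ)) / g).toNat

lemma eq_of_class_eq (i j : Fin g) (k l : ℤ)
    (hij : ((i : ℕ) : ℤ) + δ + k * g = (j : ℕ) + δ + l * g) : i = j := by
  have h1 : (((i : ℕ) : ℤ) + k * g) % g = (((j : ℕ) : ℤ) + l * g) % g := by congr 1; omega
  rw [Int.add_mul_emod_self_right, Int.add_mul_emod_self_right,
    Int.emod_eq_of_lt (by positivity) (by exact_mod_cast i.2),
    Int.emod_eq_of_lt (by positivity) (by exact_mod_cast j.2)] at h1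
  exact Fin.ext (by exact_mod_cast h1)

namespace IsChainEnds

lemma two_mul_ne (h : IsChainEnds μ δ η b) (hδ : δ ≤ 1) {i : Fin g}
    (hi : 2 * (((i : ℕ) : ℤ) + δ) ≠ g) : 2 * b i ≠ g := by
  intro hb
  obtain ⟨k, hk⟩ := h.modEq i
  have hig : ((i : ℕ) : ℤ) < g := by exact_mod_cast i.2
  have h1 : 2 * (((i : ℕ) : ℤ) + δ) = (1 - 2 * k) * g := by linarith
  have h2 : (1 - 2 * k) * g ≤ 2 * g := by rw [← h1]; omega
  have h3 : 0 ≤ (1 - 2 * k) * g := by rw [← h1]; omega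
  have hg : (0 : ℤ) < g := by omega
  have h4 : 1 - 2 * k ≤ 2 := le_of_mul_le_mul_right h2 hg
  have h5 : 0 ≤ 1 - 2 * k := nonneg_of_mul_nonneg_left h3 hg
  have h6 : k = 0 := by omega
  subst h6
  exact hi (by linarith)

lemma mem_upperClasses_iff (h : IsChainEnds μ δ η b) (hδ : δ ≤ 1) (hη : η ≤ 1) {i j : Fin g}
    (hij : ((i : ℕ) : ℤ) + δ + ((j : ℕ) + δ) = g) (hi : 2 * (((i : ℕ) : ℤ) + δ) ≠ g) :
    i ∈ upperClasses η b ↔ j ∉ upperClasses η b := by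
  have h1 := h.add_eq i j hij hi
  have h2 := h.two_mul_ne hδ hi
  simp only [upperClasses, mem_filter, mem_univ, true_and]
  omega

lemma pos_of_mem (h : IsChainEnds μ δ η b) (hη : η ≤ 1) {i : Fin g}
    (hi : i ∈ upperClasses η b) : 0 < ((i : ℕ) : ℤ) + δ := by
  have hg : 0 < g := i.pos
  by_contra h0
  have := h.zero_class i (by omega)
  simp only [upperClasses, mem_filter, mem_univ, true_and] at hi
  omega

/-- Of two conjugate classes only one is upper, so folding the lower half does not identify any. -/
lemma foldUp_injOn (h : IsChainEnds μ δ η b) (hδ : δ ≤ 1) (hη : η ≤ 1) :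
    Set.InjOn (fun i : Fin g => foldUp g ((i : ℕ) + δ)) (upperClasses η b) := by
  intro i hi j hj hij
  by_contra hne
  have hne' : ((i : ℕ) : ℤ) ≠ (j : ℕ) := fun h' => hne (Fin.ext (by exact_mod_cast h'))
  have h1 : ((i : ℕ) : ℤ) + δ + ((j : ℕ) + δ) = g ∧ 2 * (((i : ℕ) : ℤ) + δ) ≠ g := by
    simp only [foldUp] at hij
    split_ifs at hij <;> omega
  exact (h.mem_upperClasses_iff hδ hη h1.1 h1.2).1 hi hj

/-- Folded to the upper half, the upper classes have the standard starting points. -/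
lemma image_foldUp (h : IsChainEnds μ δ η b) (hδ : δ ≤ 1) (hη : η ≤ 1) :
    (upperClasses η b).image (fun i : Fin g => foldUp g ((i : ℕ) + δ)) =
      {c ∈ Icc (1 : ℤ) (g - 1 + δ) | (g : ℤ) < 2 * c + η} := by
  have hhalf : ∀ i : Fin g, 2 * (((i : ℕ) : ℤ) + δ) = g → (i ∈ upperClasses η b ↔ η = 1) := by
    intro i hi
    have := h.half_class i hi
    simp only [upperClasses, mem_filter, mem_univ, true_and]
    split_ifs at this <;> omega
  ext c
  simp only [mem_image, mem_filter, mem_Icc]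
  constructor
  · rintro ⟨i, hi, rfl⟩
    have h0 := h.pos_of_mem hη hi
    have hig := i.2
    have h1 := hhalf i
    unfold foldUp
    split_ifs with h2
    · omega
    · refine ⟨by omega, ?_⟩
      rcases eq_or_ne (2 * (((i : ℕ) : ℤ) + δ)) g with h3 | h3
      · have := (h1 h3).1 hi
        omega
      · omega
  · rintro ⟨⟨h1, h2⟩, h3⟩
    have hg : 0 < g := by omega
    set i : Fin g := ⟨(c - δ).toNat, by omega⟩ with hi
    have hic : ((i : ℕ) : ℤ) + δ = c := by simp only [hi]; omega
    by_cases hmem : i ∈ upperClasses η b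
    · refine ⟨i, hmem, ?_⟩
      rw [hic, foldUp, if_neg (by omega)]
    rcases eq_or_ne c g with hcg | hcg
    · have := h.top_class i (by omega)
      simp only [upperClasses, mem_filter, mem_univ, true_and] at hmem
      omega
    rcases eq_or_ne (2 * c) g with hcg' | hcg'
    · exact absurd ((hhalf i (by omega)).2 (by omega)) hmem
    set j : Fin g := ⟨(g - c - δ).toNat, by omega⟩ with hj
    have hjc : ((j : ℕ) : ℤ) + δ = g - c := by simp only [hj]; omega
    refine ⟨j, ?_, ?_⟩
    · by_contra hj'
      exact hmem ((h.mem_upperClasses_iff hδ hη (by omega) (by omega)).2 hj')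
    · rw [hjc, foldUp, if_pos (by omega)]
      ring

lemma sum_upperClasses (h : IsChainEnds μ δ η b) (hδ : δ ≤ 1) (hη : η ≤ 1) {φ : ℤ → A}
    (hφ : ∀ c, φ (g - c) = φ c) :
    ∑ i ∈ upperClasses η b, φ ((i : ℕ) + δ) =
      ∑ c ∈ Icc (1 : ℤ) (g - 1 + δ) with (g : ℤ) < 2 * c + η, φ c := by
  rw [← h.image_foldUp hδ hη, sum_image (h.foldUp_injOn hδ hη)]
  exact sum_congr rfl fun i _ => (apply_foldUp hφ _).symm

lemma pairSum_upperClasses (h : IsChainEnds μ δ η b) (hδ : δ ≤ 1) (hη : η ≤ 1) {K : ℤ → ℤ → A}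
    (hK : ∀ c d, K c d = K d c) (hK' : ∀ c d, K (g - c) d = K c d) :
    pairSum (fun i j : Fin g => K ((i : ℕ) + δ) ((j : ℕ) + δ)) (upperClasses η b) =
      pairSum K {c ∈ Icc (1 : ℤ) (g - 1 + δ) | (g : ℤ) < 2 * c + η} := by
  rw [← h.image_foldUp hδ hη, pairSum_image hK _ _ (h.foldUp_injOn hδ hη)]
  refine pairSum_congr fun i _ j _ => ?_
  rw [apply_foldUp (φ := fun c => K c _) (fun c => hK' c _), hK _ (foldUp g _),
    apply_foldUp (φ := fun c => K c _) (fun c => hK' c _), hK]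

lemma add_chainLength (h : IsChainEnds μ δ η b) (hδ : δ ≤ 1) (hη : η ≤ 1) {i : Fin g}
    (hi : i ∈ upperClasses η b) : ((i : ℕ) : ℤ) + δ + chainLength δ b i * g = b i := by
  have hg : (0 : ℤ) < g := by exact_mod_cast i.pos
  have hig : ((i : ℕ) : ℤ) < g := by exact_mod_cast i.2
  obtain ⟨k, hk⟩ := h.modEq i
  simp only [upperClasses, mem_filter, mem_univ, true_and] at hi
  have hk0 : 0 ≤ k := by
    by_contra hk0
    have : k * g ≤ (-1) * g := mul_le_mul_of_nonneg_right (by omega) hg.le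
    omega
  rw [chainLength, hk, add_sub_cancel_left, Int.mul_ediv_cancel _ hg.ne', Int.toNat_of_nonneg hk0]

lemma posBeads_eq (h : IsChainEnds μ δ η b) (hμ : μ.IsShiftSymmetric δ) (hη : η ≤ 1)
    (hg : 1 ≤ g) :
    μ.posBeads δ =
      chains (upperClasses η b) (fun i => ((i : ℕ) : ℤ) + δ) g (chainLength δ b) := by
  have hδ := hμ.1
  have hg0 : (0 : ℤ) < g := by omega
  ext x
  rw [hμ.mem_posBeads, mem_chains]
  constructor
  · rintro ⟨hx, hb⟩
    have hmod := Int.emod_nonneg (x - δ) hg0.ne'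
    have hmod' := Int.emod_lt_of_pos (x - δ) hg0
    have hdiv := Int.emod_add_mul_ediv (x - δ) g
    set i : Fin g := ⟨((x - δ) % g).toNat, by omega⟩ with hi
    set k := (x - δ) / g with hk
    have hix : ((i : ℕ) : ℤ) + δ + k * g = x := by
      simp only [hi, Int.toNat_of_nonneg hmod]
      linarith
    have hig : ((i : ℕ) : ℤ) < g := by exact_mod_cast i.2
    have hle := (h.bead_iff i k (by omega)).1 (by rwa [hix])
    have himem : i ∈ upperClasses η b := by
      simp only [upperClasses, mem_filter, mem_univ, true_and]
      omega
    have hk0 : 0 ≤ k := by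
      by_contra hk0
      have : k * g ≤ (-1) * g := mul_le_mul_of_nonneg_right (by omega) hg0.le
      omega
    obtain ⟨n, hn⟩ := Int.eq_ofNat_of_zero_le hk0
    refine ⟨i, himem, n, ?_, by rw [← hix, hn]⟩
    have hlen := h.add_chainLength hδ hη himem
    have h1 : (k + 1) * g ≤ chainLength δ b i * g := by linarith
    have h2 := le_of_mul_le_mul_right h1 hg0
    omega
  · rintro ⟨i, hi, n, hn, rfl⟩
    have hlen := h.add_chainLength hδ hη hi
    have hpos : 0 < ((i : ℕ) : ℤ) + δ + n * g := by
      have := h.pos_of_mem hη hi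
      positivity
    refine ⟨hpos, (h.bead_iff i n hpos).2 ?_⟩
    have : ((n : ℤ) + 1) * g ≤ chainLength δ b i * g :=
      mul_le_mul_of_nonneg_right (by omega) hg0.le
    linarith

end IsChainEnds

lemma pairSum_univ {t : ℕ} (K : Fin t → Fin t → A) :
    pairSum K univ = ∑ i, ∑ j ∈ Ioi i, K i j := by
  refine sum_congr rfl fun i _ => sum_congr ?_ fun _ _ => rfl
  ext j; simp

/-- An upper set, of cardinality `t`, of the values of a strictly decreasing sequence consists of
its first `t` values. -/
lemma image_castLE_eq_upperClasses (σ : Fin g ≃ Fin g) (hσ : StrictAnti fun j => b (σ j))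
    (ht : t ≤ g) (hcard : #(upperClasses η b) = t) :
    univ.image (fun j : Fin t => σ (Fin.castLE ht j)) = upperClasses η b := by
  have hsub : upperClasses η b ⊆ univ.image (fun j : Fin t => σ (Fin.castLE ht j)) := by
    intro i hi
    have h1 : (Iic (σ.symm i)).image σ ⊆ upperClasses η b := by
      intro k hk
      obtain ⟨l, hl, rfl⟩ := mem_image.1 hk
      have h2 := hσ.antitone (mem_Iic.1 hl)
      simp only [Equiv.apply_symm_apply] at h2
      simp only [upperClasses, mem_filter, mem_univ, true_and] at hi ⊢
      omega
    have h3 := card_le_card h1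
    rw [card_image_of_injective _ σ.injective, hcard, Fin.card_Iic] at h3
    exact mem_image.2 ⟨⟨σ.symm i, by omega⟩, mem_univ _, by simp⟩
  refine (eq_of_subset_of_card_le hsub ?_).symm
  rw [hcard]
  exact card_image_le.trans (by simp)

lemma image_standard (hstd : ∀ c : ℤ, (1 ≤ c ∧ c ≤ g - 1 + δ ∧ (g : ℤ) < 2 * c + η) ↔
      (g - t + δ ≤ c ∧ c ≤ g - 1 + δ)) :
    {c ∈ Icc (1 : ℤ) (g - 1 + δ) | (g : ℤ) < 2 * c + η} =
      univ.image fun i : Fin t => (g : ℤ) - 1 + δ - (i : ℕ) := by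
  ext c
  have := hstd c
  simp only [mem_filter, mem_Icc, mem_image, mem_univ, true_and]
  rw [and_assoc, this]
  constructor
  · rintro ⟨h1, h2⟩
    exact ⟨⟨(g - 1 + δ - c).toNat, by omega⟩, by simp only; omega⟩
  · rintro ⟨i, rfl⟩
    have := i.2
    omega

lemma standard_injective : Function.Injective fun i : Fin t => (g : ℤ) - 1 + δ - (i : ℕ) := by
  intro i j h
  simp only at h
  exact Fin.ext (by omega)

lemma IsChainEnds.card_upperClasses (h : IsChainEnds μ δ η b) (hδ : δ ≤ 1) (hη : η ≤ 1)
    (hstd : ∀ c : ℤ, (1 ≤ c ∧ c ≤ g - 1 + δ ∧ (g : ℤ) < 2 * c + η) ↔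
      (g - t + δ ≤ c ∧ c ≤ g - 1 + δ)) : #(upperClasses η b) = t := by
  rw [← card_image_of_injOn (h.foldUp_injOn hδ hη), h.image_foldUp hδ hη,
    image_standard hstd, card_image_of_injective _ standard_injective, card_univ,
    Fintype.card_fin]

/-- The sum over the boxes, as a sum over the `t` largest chain ends. -/
theorem IsChainEnds.sum_cells (h : IsChainEnds μ δ η b) (hμ : μ.IsShiftSymmetric δ) (hη : η ≤ 1)
    (hg : 1 ≤ g) (ht : t ≤ g)
    (hstd : ∀ c : ℤ, (1 ≤ c ∧ c ≤ g - 1 + δ ∧ (g : ℤ) < 2 * c + η) ↔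
      (g - t + δ ≤ c ∧ c ≤ g - 1 + δ))
    (σ : Fin g ≃ Fin g) (hσ : StrictAnti fun j => b (σ j))
    {w : Fin t → ℤ} (hw : ∀ j, w j = b (σ (Fin.castLE ht j)))
    {f ψ : ℤ → A} (hf : ∀ n, f (-n) = f n) (hψ : ∀ c, ψ (g - c) = ψ c)
    (hS : ∀ x : ℤ, ∑ c ∈ Icc (1 : ℤ) (g - 1 + δ) with (g : ℤ) < 2 * c + η, endStep f g c x =
      ∑ c ∈ Ioo (0 : ℤ) g, (f (x + c) - f (x - c)) +
      (if δ = 0 then 0 else f (x + g) - f (x - g)) - (ψ (x + g) - ψ x)) :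
    ∑ s ∈ μ.cells, (if s.2 < s.1 then f (μ.hookLength s + g) - f (μ.hookLength s)
        else f (μ.hookLength s - g) - f (μ.hookLength s)) =
      (∑ i, ∑ j ∈ Ioi i, endKernel f g (w i) (w j) + ∑ i, ψ (w i)) -
      (∑ i : Fin t, ∑ j ∈ Ioi i, endKernel f g (g - 1 + δ - (i : ℕ)) (g - 1 + δ - (j : ℕ)) +
        ∑ i : Fin t, ψ (g - 1 + δ - (i : ℕ))) := by
  have hδ := hμ.1
  have hcard := h.card_upperClasses hδ hη hstd
  have himg := image_castLE_eq_upperClasses σ hσ ht hcard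
  have hinj : Function.Injective fun j : Fin t => σ (Fin.castLE ht j) :=
    σ.injective.comp (Fin.castLE_injective ht)
  have hK := endKernel_comm hf (g : ℤ)
  have hend := fun {i} (hi : i ∈ upperClasses η b) => h.add_chainLength hδ hη hi
  have key := sum_add_pairSum_chains hf (g := g) (by omega) (I := upperClasses η b)
    (c := fun i => ((i : ℕ) : ℤ) + δ) (fun i hi => h.pos_of_mem hη hi)
    (fun i _ j _ k l hij => eq_of_class_eq i j k l hij)
    (G := beadTerm f g δ) (ψ := ψ)
    (fun x hx => by
      rw [h.sum_upperClasses hδ hη (φ := fun c => endStep f g c x)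
        (fun c => endStep_reflect f g c x)]
      exact beadTerm_identity hf hg δ hx _ (hS x)) (chainLength δ b)
  rw [← h.posBeads_eq hμ hη hg, h.pairSum_upperClasses hδ hη hK (endKernel_reflect hf g),
    h.sum_upperClasses hδ hη hψ, image_standard hstd,
    pairSum_image hK _ _ standard_injective.injOn, sum_image standard_injective.injOn,
    pairSum_congr (K' := fun i j => endKernel f g (b i) (b j))
      (fun i hi j hj => by rw [hend hi, hend hj]),
    sum_congr rfl (fun i hi => by rw [hend hi] :
      ∀ i ∈ upperClasses η b, ψ (((i : ℕ) : ℤ) + δ + chainLength δ b i * g) = ψ (b i)),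
    ← himg, pairSum_image (fun _ _ => hK _ _) _ _ hinj.injOn, sum_image hinj.injOn, pairSum_univ,
    pairSum_univ] at key
  simp only [← hw] at key
  rw [← key]
  have := hμ.sum_cells (fun n => f (n - g) - f n) (fun n => f (n + g) - f n)
    (fun n => secondDiff_neg hf g n)
  exact this

/-- The size of the partition, in terms of the `t` largest chain ends. -/
theorem IsChainEnds.card_eq (h : IsChainEnds μ δ η b) (hμ : μ.IsShiftSymmetric δ) (hη : η ≤ 1)
    (hg : 1 ≤ g) (ht : t ≤ g)
    (hstd : ∀ c : ℤ, (1 ≤ c ∧ c ≤ g - 1 + δ ∧ (g : ℤ) < 2 * c + η) ↔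
      (g - t + δ ≤ c ∧ c ≤ g - 1 + δ))
    (σ : Fin g ≃ Fin g) (hσ : StrictAnti fun j => b (σ j))
    {w : Fin t → ℤ} (hw : ∀ j, w j = b (σ (Fin.castLE ht j))) :
    (μ.card : ℚ) = 1 / g * (∑ i, ((w i : ℚ) - g / 2) ^ 2 -
      ∑ i : Fin t, ((g : ℚ) - 1 + δ - (i : ℕ) - g / 2) ^ 2) := by
  have hδ := hμ.1
  have hg0 : (g : ℚ) ≠ 0 := by positivity
  have hcard := h.card_upperClasses hδ hη hstd
  have himg := image_castLE_eq_upperClasses σ hσ ht hcard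
  have hinj : Function.Injective fun j : Fin t => σ (Fin.castLE ht j) :=
    σ.injective.comp (Fin.castLE_injective ht)
  have h1 : (μ.card : ℚ) = ∑ p ∈ μ.posBeads δ, 2 * (p : ℚ) := by
    have := congrArg (Int.cast : ℤ → ℚ) hμ.card_eq
    push_cast at this
    exact this
  have h2 : ∀ i ∈ upperClasses η b, ∑ k ∈ range (chainLength δ b i),
      2 * (((((i : ℕ) : ℤ) + δ + k * g : ℤ)) : ℚ) =
      1 / g * (((b i : ℚ) - g / 2) ^ 2 - ((((i : ℕ) + δ : ℤ) : ℚ) - g / 2) ^ 2) := by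
    intro i hi
    have hs := Finset.sum_range_sub
      (fun k : ℕ => 1 / (g : ℚ) * (((i : ℕ) : ℚ) + δ + k * g - g / 2) ^ 2) (chainLength δ b i)
    have hb : (b i : ℚ) = (i : ℕ) + δ + chainLength δ b i * g := by
      rw [← h.add_chainLength hδ hη hi]; push_cast; ring
    rw [hb, mul_sub]
    push_cast
    simp only [Nat.cast_zero, zero_mul, add_zero] at hs
    rw [← hs]
    refine sum_congr rfl fun k _ => ?_
    push_cast
    field_simp
    ring
  have h3 : ∑ i ∈ upperClasses η b, ((((i : ℕ) + δ : ℤ) : ℚ) - g / 2) ^ 2 =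
      ∑ i : Fin t, ((g : ℚ) - 1 + δ - (i : ℕ) - g / 2) ^ 2 := by
    rw [h.sum_upperClasses hδ hη (φ := fun c => ((c : ℚ) - g / 2) ^ 2)
      (fun c => by push_cast; ring), image_standard hstd, sum_image standard_injective.injOn]
    push_cast
    rfl
  rw [h1, h.posBeads_eq hμ hη hg, sum_chains (by omega)
    (fun i _ j _ k l hij => eq_of_class_eq i j k l hij), sum_congr rfl h2, ← mul_sum,
    sum_sub_distrib, h3, ← himg, sum_image hinj.injOn]
  simp only [← hw]

end ChainEnds

/-! ### Residue classes of beads, cores and quotients -/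

section ResidueClasses

variable {μ : YoungDiagram} {δ g η : ℕ}

/-- The beads in the residue class of `c` modulo `g` form an initial segment. -/
def IsInitialClass (μ : YoungDiagram) (δ g : ℕ) (c : ℤ) : Prop :=
  ∀ k l : ℤ, l ≤ k → μ.Bead δ (c + k * g) → μ.Bead δ (c + l * g)

/-- Among `c, c + g, c + 2 g, …` the beads are `c, …, c + (M - 1) g`; if there are none, then
`c - g` is a bead. So the largest bead of the class is `c + (M - 1) g` in every case. -/
def IsPosInitialClass (μ : YoungDiagram) (δ g : ℕ) (c : ℤ) : Prop :=
  ∃ M : ℕ, (M = 0 → μ.Bead δ (c + (-1) * g)) ∧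
    ∀ k : ℤ, 0 ≤ k → (μ.Bead δ (c + k * g) ↔ k < M)

/-- `b` is the largest bead in the residue class of `c` modulo `g`, plus `g`. -/
def IsClassEnd (μ : YoungDiagram) (δ g : ℕ) (c b : ℤ) : Prop :=
  IsGreatest {m : ℤ | ∃ k : ℤ, μ.Bead δ (c + k * g) ∧ m = c + (k + 1) * g} b

lemma IsInitialClass.exists_end {c b : ℤ} (h : IsInitialClass μ δ g c)
    (hb : IsClassEnd μ δ g c b) (hg : 1 ≤ g) :
    ∃ k : ℤ, b = c + k * g ∧ ∀ l : ℤ, μ.Bead δ (c + l * g) ↔ l < k := by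
  obtain ⟨⟨k, hk, rfl⟩, hmax⟩ := hb
  refine ⟨k + 1, rfl, fun l => ⟨fun hl => ?_, fun hl => h k l (by omega) hk⟩⟩
  have h1 := hmax ⟨l, hl, rfl⟩
  have h2 : (l + 1) * (g : ℤ) ≤ (k + 1) * g := by linarith
  have h3 := le_of_mul_le_mul_right h2 (by omega)
  omega

lemma IsPosInitialClass.exists_end {c b : ℤ} (h : IsPosInitialClass μ δ g c)
    (hb : IsClassEnd μ δ g c b) (hg : 1 ≤ g) :
    ∃ M : ℕ, b = c + M * g ∧ ∀ l : ℤ, 0 ≤ l → (μ.Bead δ (c + l * g) ↔ l < M) := by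
  obtain ⟨⟨k, hk, rfl⟩, hmax⟩ := hb
  obtain ⟨M, h0, hM⟩ := h
  refine ⟨M, ?_, hM⟩
  suffices k + 1 = M by rw [this]
  have hlast : μ.Bead δ (c + ((M : ℤ) - 1) * g) := by
    rcases Nat.eq_zero_or_pos M with rfl | hpos
    · simpa using h0 rfl
    · exact (hM _ (by omega)).2 (by omega)
  have h1 := hmax ⟨_, hlast, rfl⟩
  have h2 : ((M : ℤ) - 1 + 1) * (g : ℤ) ≤ (k + 1) * g := by linarith
  have h3 := le_of_mul_le_mul_right h2 (by omega)
  by_contra hne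
  have := (hM k (by omega)).1 hk
  omega

/-- The symmetry of the beads exchanges the classes of `c` and `g - c`, so their ends are reflected
at `g / 2`. -/
lemma IsInitialClass.end_add_end (hμ : μ.IsShiftSymmetric δ) {c d b b' : ℤ}
    (hc : IsInitialClass μ δ g c) (hd : IsInitialClass μ δ g d) (hb : IsClassEnd μ δ g c b)
    (hb' : IsClassEnd μ δ g d b') (hcd : c + d = g) (hc0 : 0 < c) (hcg : c < g) : b + b' = g := by
  have hg : 1 ≤ g := by omega
  obtain ⟨k, rfl, hk⟩ := hc.exists_end hb hg
  obtain ⟨l, rfl, hl⟩ := hd.exists_end hb' hg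
  have key : ∀ n : ℤ, n < l ↔ n < -k := by
    intro n
    have hne : c + (-1 - n) * g ≠ 0 := by
      intro h0
      have h1 : c = (n + 1) * g := by linarith
      have h2 : 0 < n + 1 := pos_of_mul_pos_left (h1 ▸ hc0) (by omega)
      have h3 : 1 * (g : ℤ) ≤ (n + 1) * g := mul_le_mul_of_nonneg_right (by omega) (by omega)
      omega
    rw [← hl, show d + n * g = -(c + (-1 - n) * g) by rw [← hcd]; ring,
      hμ.bead_neg_iff hne, hk]
    omega
  have : l = -k := by
    have h1 := key (l - 1)
    have h2 := key l
    have h3 := key (-k)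
    omega
  rw [this]
  linarith

/-- It suffices to know that every class is an initial segment, apart from the two self-conjugate
classes, which need only be so on the positive side. -/
lemma isChainEnds_of_isClassEnd (hμ : μ.IsShiftSymmetric δ) (hg : 1 ≤ g)
    {b : Fin g → ℤ} (hb : ∀ i : Fin g, IsClassEnd μ δ g ((i : ℕ) + δ) (b i))
    (htop : ∀ i : Fin g, ((i : ℕ) : ℤ) + δ = g → IsPosInitialClass μ δ g ((i : ℕ) + δ))
    (hhalf : η = 1 → ∀ i : Fin g, 2 * (((i : ℕ) : ℤ) + δ) = g →
      IsPosInitialClass μ δ g ((i : ℕ) + δ))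
    (hinit : ∀ i : Fin g, ((i : ℕ) : ℤ) + δ ≠ g → ¬ (η = 1 ∧ 2 * (((i : ℕ) : ℤ) + δ) = g) →
      IsInitialClass μ δ g ((i : ℕ) + δ)) :
    IsChainEnds μ δ η b := by
  have hδ := hμ.1
  have hg0 : (0 : ℤ) < g := by omega
  have hpos : ∀ i : Fin g, 0 < ((i : ℕ) : ℤ) + δ → IsPosInitialClass μ δ g ((i : ℕ) + δ) →
      ∃ M : ℕ, b i = (i : ℕ) + δ + M * g ∧ ∀ l : ℤ, 0 < ((i : ℕ) : ℤ) + δ + l * g →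
        (μ.Bead δ ((i : ℕ) + δ + l * g) ↔ l < M) := by
    intro i hi h
    obtain ⟨M, hM, hM'⟩ := h.exists_end (hb i) hg
    refine ⟨M, hM, fun l hl => hM' l ?_⟩
    by_contra hl0
    have h1 : l * (g : ℤ) ≤ (-1) * g := mul_le_mul_of_nonneg_right (by omega) hg0.le
    have := i.2
    omega
  have hcase : ∀ i : Fin g, ∃ M : ℤ, b i = (i : ℕ) + δ + M * g ∧
      ∀ l : ℤ, 0 < ((i : ℕ) : ℤ) + δ + l * g → (μ.Bead δ ((i : ℕ) + δ + l * g) ↔ l < M) := by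
    intro i
    by_cases h1 : ((i : ℕ) : ℤ) + δ = g
    · obtain ⟨M, hM⟩ := hpos i (by omega) (htop i h1)
      exact ⟨M, hM⟩
    by_cases h2 : η = 1 ∧ 2 * (((i : ℕ) : ℤ) + δ) = g
    · obtain ⟨M, hM⟩ := hpos i (by omega) (hhalf h2.1 i h2.2)
      exact ⟨M, hM⟩
    obtain ⟨k, hk, hk'⟩ := (hinit i h1 h2).exists_end (hb i) hg
    exact ⟨k, hk, fun l _ => hk' l⟩
  refine ⟨fun i => ?_, fun i k hk => ?_, fun i j hij hi => ?_, fun i hi => ?_, fun i hi => ?_,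
    fun i hi => ?_⟩
  · obtain ⟨M, hM, -⟩ := hcase i
    exact ⟨M, hM⟩
  · obtain ⟨M, hM, hM'⟩ := hcase i
    rw [hM' k hk, hM, add_assoc, ← add_one_mul, add_le_add_iff_left,
      mul_le_mul_iff_left₀ hg0, Int.add_one_le_iff]
  · have hi' := i.2
    have hj' := j.2
    exact (hinit i (by omega) (by omega)).end_add_end hμ (hinit j (by omega) (by omega)) (hb i)
      (hb j) hij (by omega) (by omega)
  · have hδ0 : δ = 0 := by omega
    obtain ⟨k, hk, hk'⟩ := (hinit i (by omega) (by omega)).exists_end (hb i) hg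
    rw [hi, zero_add] at hk
    rw [hi] at hk'
    have h0 : ¬ μ.Bead δ 0 := by rw [hμ.bead_zero_iff]; omega
    have h1 := (hk' 0).not.1 (by simpa using h0)
    have h2 := (hk' 1).not.2 (by omega)
    rw [zero_add, one_mul] at h2
    have h3 := (hk' (-1)).1 (by
      rw [zero_add, neg_one_mul]
      exact (hμ.bead_neg_iff hg0.ne').2 h2)
    rw [hk, show k = 0 by omega, zero_mul]
  · obtain ⟨M, hM, -⟩ := hpos i (by omega) (htop i hi)
    rw [hM, hi]
    have : 0 ≤ (M : ℤ) * g := by positivity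
    omega
  · split_ifs with h1
    · obtain ⟨M, hM, -⟩ := hpos i (by omega) (hhalf h1 i hi)
      have : 0 ≤ (M : ℤ) * g := by positivity
      omega
    · have h := hinit i (by omega) (by omega)
      have := h.end_add_end hμ h (hb i) (hb i) (by omega) (by omega) (by omega)
      omega

lemma IsCore.isInitialClass (h : μ.IsCore g) (c : ℤ) : IsInitialClass μ δ g c := by
  intro k l hlk hk
  by_contra hl
  obtain ⟨i, hi⟩ := hk
  obtain ⟨j, hj⟩ := not_bead_iff.1 hl
  rcases hlk.eq_or_lt with rfl | hlt
  · exact hl ⟨i, hi⟩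
  have hle : l * (g : ℤ) ≤ k * g := mul_le_mul_of_nonneg_right hlk (by omega)
  have hne := μ.rowBead_ne_colBead i j
  have hmem := (μ.mem_iff_colBead_lt i j).2 (by omega)
  refine h _ ((mem_cells _).2 hmem) ?_
  have h1 := μ.hookLength_eq hmem
  have h2 : (μ.hookLength (i, j) : ℤ) = g * (k - l) := by
    rw [h1]; simp only; linarith
  exact Int.natCast_dvd_natCast.1 ⟨_, h2⟩

lemma word_bot (m : ℤ) : (⊥ : YoungDiagram).word m = 0 ↔ m < 0 := by
  rw [word_eq_zero_iff]
  have h : ∀ i, (⊥ : YoungDiagram).rowLen i = 0 := fun i => by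
    by_contra h
    exact notMem_bot (i, 0) (mem_iff_lt_rowLen.2 (Nat.pos_of_ne_zero h))
  simp only [rowBead, h]
  constructor
  · rintro ⟨i, rfl⟩; omega
  · intro h; exact ⟨(-m - 1).toNat, by omega⟩

lemma word_rectangle (a b : ℕ) (m : ℤ) :
    (rectangle a b).word m = 0 ↔ m < -a ∨ ((b : ℤ) - a ≤ m ∧ m < b) := by
  rw [word_eq_zero_iff]
  have hmem : ∀ i j, (i, j) ∈ rectangle a b ↔ i < a ∧ j < b := fun i j => by
    rw [← mem_cells]; simp [rectangle]
  have h1 : ∀ i, i < a → (rectangle a b).rowLen i = b := fun i hi => by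
    refine le_antisymm ?_ ?_
    · by_contra h
      have := (hmem i b).1 (mem_iff_lt_rowLen.2 (by omega))
      omega
    · by_contra h
      have := mem_iff_lt_rowLen.1 ((hmem i ((rectangle a b).rowLen i)).2 ⟨hi, by omega⟩)
      omega
  have h2 : ∀ i, a ≤ i → (rectangle a b).rowLen i = 0 := fun i hi => by
    by_contra h
    have := (hmem i 0).1 (mem_iff_lt_rowLen.2 (Nat.pos_of_ne_zero h))
    omega
  constructor
  · rintro ⟨i, rfl⟩
    unfold rowBead
    rcases lt_or_ge i a with hi | hi
    · rw [h1 i hi]; omega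
    · rw [h2 i hi]; omega
  · rintro (h | h)
    · exact ⟨(-m - 1).toNat, by unfold rowBead; rw [h2 _ (by omega)]; omega⟩
    · exact ⟨(b - m - 1).toNat, by unfold rowBead; rw [h1 _ (by omega)]; omega⟩

lemma IsQuotientComponent.exists_bead_iff {k : ℕ} {ν : YoungDiagram}
    (h : μ.IsQuotientComponent g k ν) (δ : ℕ) :
    ∃ n : ℤ, ∀ m : ℤ, μ.Bead δ (k + δ + m * g) ↔ ν.word (m - n) = 0 := by
  obtain ⟨n, hn⟩ := h
  refine ⟨n, fun m => ?_⟩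
  rw [hn, sub_add_cancel, bead_iff_word, show (k : ℤ) + δ + m * g - δ = m * g + k by ring]

lemma IsQuotientComponent.isInitialClass {k : ℕ} (h : μ.IsQuotientComponent g k ⊥) :
    IsInitialClass μ δ g (k + δ) := by
  obtain ⟨n, hn⟩ := h.exists_bead_iff δ
  intro i j hij hi
  rw [hn, word_bot] at hi ⊢
  omega

/-- The symmetry of the beads forces the origin of a component of shape `m₁ × (m₁ - 1)`. -/
lemma IsQuotientComponent.isPosInitialClass_top (hμ : μ.IsShiftSymmetric 1) {k m₁ : ℕ}
    (hm : 1 ≤ m₁) (hk : k + 1 = g) (h : μ.IsQuotientComponent g k (rectangle m₁ (m₁ - 1))) :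
    IsPosInitialClass μ 1 g (k + (1 : ℕ)) := by
  obtain ⟨n, hn⟩ := h.exists_bead_iff 1
  have hg : (g : ℤ) ≠ 0 := by omega
  have hkg : (k : ℤ) + (1 : ℕ) = g := by omega
  simp only [word_rectangle, hkg] at hn ⊢
  have hB : ∀ y : ℤ, μ.Bead 1 (y * g) ↔
      y - 1 - n < -m₁ ∨ (((m₁ - 1 : ℕ) : ℤ) - m₁ ≤ y - 1 - n ∧ y - 1 - n < (m₁ - 1 : ℕ)) := by
    intro y
    rw [← hn, show (g : ℤ) + (y - 1) * g = y * g by ring]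
  have h0 := (hB 0).1 (by rw [zero_mul]; exact hμ.bead_zero_iff.2 rfl)
  have hsymm : ∀ y : ℤ, y ≠ 0 → (μ.Bead 1 ((-y) * g) ↔ ¬ μ.Bead 1 (y * g)) := by
    intro y hy
    rw [neg_mul, hμ.bead_neg_iff (mul_ne_zero hy hg)]
  simp only [hB] at hsymm
  -- The last bead and the first gap of the class determine the origin.
  have h1 := hsymm (n + m₁ - 1)
  have h2 := hsymm (n - m₁ + 1)
  have hn0 : n = 0 := by omega
  subst hn0
  refine ⟨m₁ - 1, fun _ => (hn (-1)).2 (by omega), fun l hl => ?_⟩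
  rw [hn]
  omega

/-- The symmetry of the beads forces the origin of a square component. -/
lemma IsQuotientComponent.isPosInitialClass_half (hμ : μ.IsShiftSymmetric 1) {k m : ℕ}
    (hg : 1 ≤ g) (hk : 2 * (k + 1) = g) (h : μ.IsQuotientComponent g k (rectangle m m)) :
    IsPosInitialClass μ 1 g (k + (1 : ℕ)) := by
  obtain ⟨n, hn⟩ := h.exists_bead_iff 1
  simp only [word_rectangle] at hn ⊢
  have hkg : (g : ℤ) = 2 * ((k : ℤ) + (1 : ℕ)) := by omega
  have hsymm : ∀ y : ℤ, μ.Bead 1 (k + (1 : ℕ) + (-1 - y) * g) ↔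
      ¬ μ.Bead 1 (k + (1 : ℕ) + y * g) := by
    intro y
    have hne : (k : ℤ) + (1 : ℕ) + y * g ≠ 0 := by
      rw [hkg, show (k : ℤ) + (1 : ℕ) + y * (2 * (k + (1 : ℕ))) =
        (k + (1 : ℕ)) * (1 + 2 * y) by ring]
      exact mul_ne_zero (by omega) (by omega)
    rw [← hμ.bead_neg_iff hne, hkg]
    ring_nf
  simp only [hn] at hsymm
  -- The last bead and the two ends of the first gap of the class determine the origin.
  have h1 := hsymm (n + m - 1)
  have h2 := hsymm (n - 1)
  have h3 := hsymm (n - m)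
  have hn0 : n = 0 := by omega
  subst hn0
  refine ⟨m, fun _ => (hn (-1)).2 (by omega), fun l hl => ?_⟩
  rw [hn]
  omega

end ResidueClasses

/-! ### Products over the boxes -/

section Products

variable {F : Type*} [Field F] {μ : YoungDiagram} {δ g η t : ℕ}

/-- The boxes of sign `1` and hook length less than `g` are those for which the argument
`h - g` of `τ` is negative; replacing it by its absolute value produces the first factor. -/
lemma prod_cells_eq_signedHookCount_mul (μ : YoungDiagram) (g : ℕ) (τ : ℤ → Fˣ) :
    ∏ s ∈ μ.cells, τ ((μ.hookLength s : ℤ) - boxSign s * g) / τ (μ.hookLength s) =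
      (∏ i ∈ Icc 1 (g - 1), (τ (-(i : ℤ)) / τ i) ^ μ.signedHookCount g i) *
        ∏ s ∈ μ.cells, (if s.2 < s.1 then τ |(μ.hookLength s : ℤ) + g| / τ |(μ.hookLength s : ℤ)|
          else τ |(μ.hookLength s : ℤ) - g| / τ |(μ.hookLength s : ℤ)|) := by
  have h1 : ∀ i ∈ Icc 1 (g - 1), (τ (-(i : ℤ)) / τ i) ^ μ.signedHookCount g i =
      ∏ s ∈ μ.cells, if (μ.hookLength s : ℤ) = (g : ℤ) - i ∧ boxSign s = 1
        then τ (-(i : ℤ)) / τ i else 1 := by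
    intro i _
    rw [← prod_filter, prod_const, signedHookCount]
  rw [prod_congr rfl h1, prod_comm, ← prod_mul_distrib]
  refine prod_congr rfl fun s _ => ?_
  have hh : 1 ≤ μ.hookLength s := by unfold hookLength; omega
  rw [abs_of_nonneg (Int.natCast_nonneg (μ.hookLength s))]
  by_cases hs : s.2 < s.1
  · have hsign : boxSign s = -1 := if_pos hs
    rw [prod_eq_one fun i _ => if_neg (by rw [hsign]; norm_num), one_mul, if_pos hs, hsign,
      abs_of_nonneg (by positivity)]
    congr 2; ring
  have hsign : boxSign s = 1 := if_neg hs
  rw [if_neg hs, hsign, one_mul]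
  rcases lt_or_ge (μ.hookLength s) g with hlt | hge
  · rw [prod_eq_single (g - μ.hookLength s), if_pos ⟨by omega, rfl⟩, abs_of_nonpos (by omega),
      show (-((g - μ.hookLength s : ℕ) : ℤ)) = (μ.hookLength s : ℤ) - g by omega,
      show ((g - μ.hookLength s : ℕ) : ℤ) = -((μ.hookLength s : ℤ) - g) by omega,
      div_mul_div_cancel]
    · intro i _ hi
      exact if_neg (by omega)
    · intro hi
      exact absurd (mem_Icc.2 ⟨by omega, by omega⟩) hi
  · rw [prod_eq_one fun i hi => if_neg (by have := mem_Icc.1 hi; omega), one_mul,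
      abs_of_nonneg (by omega)]

lemma IsChainEnds.lt_two_mul {b : Fin g → ℤ} (h : IsChainEnds μ δ η b)
    (hμ : μ.IsShiftSymmetric δ) (hη : η ≤ 1)
    (hstd : ∀ c : ℤ, (1 ≤ c ∧ c ≤ g - 1 + δ ∧ (g : ℤ) < 2 * c + η) ↔
      (g - t + δ ≤ c ∧ c ≤ g - 1 + δ))
    (σ : Fin g ≃ Fin g) (hσ : StrictAnti fun j => b (σ j)) (ht : t ≤ g) (i : Fin t) :
    (g : ℤ) < 2 * b (σ (Fin.castLE ht i)) + η := by
  have himg := image_castLE_eq_upperClasses σ hσ ht (h.card_upperClasses hμ.1 hη hstd)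
  have hi : σ (Fin.castLE ht i) ∈ upperClasses η b := himg ▸ mem_image_of_mem _ (mem_univ i)
  simpa only [upperClasses, mem_filter, mem_univ, true_and] using hi

/-- The product over the boxes, as a product over the `t` largest chain ends. -/
theorem IsChainEnds.prod_cells {b : Fin g → ℤ} (h : IsChainEnds μ δ η b)
    (hμ : μ.IsShiftSymmetric δ) (hη : η ≤ 1) (hg : 1 ≤ g) (ht : t ≤ g)
    (hstd : ∀ c : ℤ, (1 ≤ c ∧ c ≤ g - 1 + δ ∧ (g : ℤ) < 2 * c + η) ↔
      (g - t + δ ≤ c ∧ c ≤ g - 1 + δ))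
    (σ : Fin g ≃ Fin g) (hσ : StrictAnti fun j => b (σ j))
    {w : Fin t → ℤ} (hw : ∀ j, w j = b (σ (Fin.castLE ht j)))
    (τ : ℤ → Fˣ) (Ψ : ℤ → Fˣ) (hΨ : ∀ c, Ψ (g - c) = Ψ c)
    (hS : ∀ (f ψ : ℤ → Additive Fˣ), (∀ n, f n = Additive.ofMul (τ |n|)) →
      (∀ n, ψ n = Additive.ofMul (Ψ n)) → ∀ x : ℤ,
      ∑ c ∈ Icc (1 : ℤ) (g - 1 + δ) with (g : ℤ) < 2 * c + η, endStep f g c x =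
      ∑ c ∈ Ioo (0 : ℤ) g, (f (x + c) - f (x - c)) +
      (if δ = 0 then 0 else f (x + g) - f (x - g)) - (ψ (x + g) - ψ x)) :
    ∏ s ∈ μ.cells, τ ((μ.hookLength s : ℤ) - boxSign s * g) / τ (μ.hookLength s) =
      (∏ i ∈ Icc 1 (g - 1), (τ (-(i : ℤ)) / τ i) ^ μ.signedHookCount g i) *
        (∏ i : Fin t, Ψ (w i) / Ψ (g - 1 + δ - (i : ℕ))) *
        ∏ i : Fin t, ∏ j ∈ Ioi i, (τ (w i - w j) / τ ((j : ℕ) - (i : ℕ) : ℤ)) *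
          (τ (w i + w j - g) / τ ((g : ℤ) + 2 * δ - ((i : ℕ) + 1) - ((j : ℕ) + 1))) := by
  have key := congrArg Additive.toMul (h.sum_cells hμ hη hg ht hstd σ hσ hw
    (f := fun n => Additive.ofMul (τ |n|)) (ψ := fun n => Additive.ofMul (Ψ n))
    (fun n => by rw [abs_neg]) (fun c => by rw [hΨ]) (hS _ _ (fun _ => rfl) (fun _ => rfl)))
  simp only [endKernel, toMul_sum, toMul_add, toMul_sub, apply_ite Additive.toMul,
    toMul_ofMul] at key
  rw [prod_cells_eq_signedHookCount_mul, key, mul_assoc, mul_div_mul_comm,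
    ← prod_div_distrib, ← prod_div_distrib, mul_comm (∏ i : Fin t, (_ / _))]
  congr 2
  refine prod_congr rfl fun i _ => ?_
  rw [← prod_div_distrib]
  refine prod_congr rfl fun j hj => ?_
  have hij : i < j := mem_Ioi.1 hj
  have hij' : (i : ℕ) < j := hij
  have hjt := j.2
  have hlt : w j < w i := by
    rw [hw, hw]
    exact hσ (by simpa using hij)
  have h1 := h.lt_two_mul hμ hη hstd σ hσ ht i
  have h2 := h.lt_two_mul hμ hη hstd σ hσ ht j
  rw [← hw] at h1 h2
  -- The lower bound of the standard ends makes the remaining arguments of `τ` non-negative.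
  have h3 := (hstd (g - t + δ)).2 ⟨le_rfl, by omega⟩
  rw [mul_div_mul_comm, abs_of_nonneg (by omega), abs_of_nonneg (by omega),
    abs_of_nonneg (by omega), abs_of_nonneg (by omega)]
  congr 3 <;> ring_nf

end Products

/-! ### Standard chain ends and the coding -/

section Specialisation

variable {A : Type*} [AddCommGroup A] {μ : YoungDiagram} {δ g η t : ℕ}

/-- The steps summed over the standard starting points. By reflection they cover each class of
`Ioo 0 g` once, up to the self-conjugate class `2 * c = g`, which is missing for `η = 0` and counted
twice for `η = 1`; for `δ = 1` the class of `g` is added. -/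
lemma sum_endStep_standard (f : ℤ → A) (hg : 1 ≤ g) (hδ : δ ≤ 1) (hη : η ≤ δ) (x : ℤ) :
    ∑ c ∈ Icc (1 : ℤ) (g - 1 + δ) with (g : ℤ) < 2 * c + η, endStep f g c x =
      ∑ c ∈ Ioo (0 : ℤ) g, (f (x + c) - f (x - c)) +
      (if δ = 0 then 0 else f (x + g) - f (x - g)) +
      (if η = 0 then -∑ c ∈ Ioo (0 : ℤ) g with 2 * c = (g : ℤ), (f (x + c) - f (x - c))
        else ∑ c ∈ Ioo (0 : ℤ) g with 2 * c = (g : ℤ), (f (x + c) - f (x - c))) := by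
  have hup := sum_endStep_upper_half f g x
  have htop : endStep f g g x = f (x + g) - f (x - g) := by
    rw [endStep_eq]; simp
  have hins : ∀ n : ℕ, {c ∈ Icc (1 : ℤ) (g - 1 + (1 : ℕ)) | (g : ℤ) < 2 * c + n} =
      insert (g : ℤ) {c ∈ Ioo (0 : ℤ) g | (g : ℤ) < 2 * c + n} := by
    intro n; ext c; simp only [mem_filter, mem_Icc, mem_insert, mem_Ioo]; omega
  have h0 : ∀ c ∈ Ioo (0 : ℤ) g, (g : ℤ) < 2 * c + (0 : ℕ) ↔ (g : ℤ) < 2 * c := by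
    intro c _; omega
  rcases Nat.le_one_iff_eq_zero_or_eq_one.1 hδ with rfl | rfl
  · obtain rfl : η = 0 := by omega
    have h1 : {c ∈ Icc (1 : ℤ) (g - 1 + (0 : ℕ)) | (g : ℤ) < 2 * c + (0 : ℕ)} =
        {c ∈ Ioo (0 : ℤ) g | (g : ℤ) < 2 * c} := by
      ext c; simp only [mem_filter, mem_Icc, mem_Ioo]; omega
    rw [h1, hup, if_pos rfl, if_pos rfl]
    abel
  rw [hins, sum_insert (by simp), htop, if_neg one_ne_zero]
  rcases Nat.le_one_iff_eq_zero_or_eq_one.1 hη with rfl | rfl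
  · rw [filter_congr h0, hup, if_pos rfl]
    abel
  · have h1 : {c ∈ Ioo (0 : ℤ) g | (g : ℤ) < 2 * c + (1 : ℕ)} =
        {c ∈ Ioo (0 : ℤ) g | (g : ℤ) < 2 * c} ∪ {c ∈ Ioo (0 : ℤ) g | 2 * c = (g : ℤ)} := by
      ext c; simp only [mem_filter, mem_union, mem_Ioo]; omega
    have hhalf : ∀ c ∈ {c ∈ Ioo (0 : ℤ) g | 2 * c = (g : ℤ)},
        endStep f g c x = (f (x + c) - f (x - c)) + (f (x + c) - f (x - c)) := by
      intro c hc
      have : (g : ℤ) - c = c := by have := (mem_filter.1 hc).2; omega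
      rw [endStep_eq, this]
    rw [h1, sum_union (by
      rw [disjoint_left]; intro c; simp only [mem_filter]; omega), hup, sum_congr rfl hhalf,
      sum_add_distrib, if_neg one_ne_zero]
    abel

lemma sum_half_of_odd (φ : ℤ → A) (hg : Odd g) :
    ∑ c ∈ Ioo (0 : ℤ) g with 2 * c = (g : ℤ), φ c = 0 := by
  obtain ⟨k, hk⟩ := hg
  refine sum_eq_zero fun c hc => ?_
  have := (mem_filter.1 hc).2
  omega

lemma sum_half_of_even (φ : ℤ → A) {k : ℕ} (hk : 1 ≤ k) (hg : g = 2 * k) :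
    ∑ c ∈ Ioo (0 : ℤ) g with 2 * c = (g : ℤ), φ c = φ k := by
  have : {c ∈ Ioo (0 : ℤ) g | 2 * c = (g : ℤ)} = {(k : ℤ)} := by
    ext c; simp only [mem_filter, mem_Ioo, mem_singleton]; omega
  rw [this, sum_singleton]

lemma sum_fin_sub_sq (x : ℚ) (t : ℕ) :
    ∑ i : Fin t, (x - (i : ℕ)) ^ 2 =
      t * x ^ 2 - x * t * (t - 1) + (t : ℚ) * (t - 1) * (2 * t - 1) / 6 := by
  induction t with
  | zero => simp
  | succ n ih =>
    rw [Fin.sum_univ_castSucc]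
    simp only [Fin.val_castSucc, Fin.val_last, ih]
    push_cast
    ring

lemma isClassEnd_of_isGreatest {i : ℕ} {β : ℤ} (δ : ℕ)
    (h : IsGreatest {m : ℤ | ∃ k : ℤ, μ.word (k * g + i) = 0 ∧ m = (k + 1) * g + i} β) :
    IsClassEnd μ δ g (i + δ) (β + δ) := by
  have hB : ∀ k : ℤ, μ.Bead δ (i + δ + k * g) ↔ μ.word (k * g + i) = 0 := fun k => by
    rw [bead_iff_word, show (i : ℤ) + δ + k * g - δ = k * g + i by ring]
  obtain ⟨⟨k, hk, rfl⟩, hmax⟩ := h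
  refine ⟨⟨k, (hB k).2 hk, by ring⟩, ?_⟩
  rintro m ⟨l, hl, rfl⟩
  have := hmax ⟨l, (hB l).1 hl, rfl⟩
  linarith

lemma IsDDPrimeOne.isChainEnds (h : μ.IsDDPrimeOne g) (hg : 1 ≤ g) {b : Fin g → ℤ}
    (hb : ∀ i : Fin g, IsClassEnd μ 1 g ((i : ℕ) + (1 : ℕ)) (b i)) : IsChainEnds μ 1 0 b := by
  obtain ⟨hdd, m₁, hm₁, hq⟩ := h
  have hμ := isShiftSymmetric_one_of_transpose hdd
  refine isChainEnds_of_isClassEnd hμ hg hb (fun i hi => ?_) (by omega) (fun i hi _ => ?_)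
  · have hi' : (i : ℕ) + 1 = g := by omega
    have := hq i i.2
    rw [if_pos hi'] at this
    exact this.isPosInitialClass_top hμ hm₁ hi'
  · have := hq i i.2
    rw [if_neg (by omega)] at this
    exact this.isInitialClass

lemma IsDDPrimeTwo.isChainEnds (h : μ.IsDDPrimeTwo g) (hg : 1 ≤ g) {b : Fin g → ℤ}
    (hb : ∀ i : Fin g, IsClassEnd μ 1 g ((i : ℕ) + (1 : ℕ)) (b i)) : IsChainEnds μ 1 1 b := by
  obtain ⟨hdd, m₁, m, hm₁, hq⟩ := h
  have hμ := isShiftSymmetric_one_of_transpose hdd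
  refine isChainEnds_of_isClassEnd hμ hg hb (fun i hi => ?_) (fun _ i hi => ?_)
    (fun i hi hi' => ?_)
  · have hi' : (i : ℕ) + 1 = g := by omega
    have := hq i i.2
    rw [if_pos hi'] at this
    exact this.isPosInitialClass_top hμ hm₁ hi'
  · have := hq i i.2
    rw [if_neg (by omega), if_pos (by omega)] at this
    exact this.isPosInitialClass_half hμ hg (by omega)
  · have := hq i i.2
    rw [if_neg (by omega), if_neg (by omega)] at this
    exact this.isInitialClass

end Specialisation

/-! ### The four families -/

section Cases

variable {F : Type*} [Field F] {μ : YoungDiagram} {g t : ℕ} {v : Fin t → ℤ}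

/-- The family of doubled distinct cores: the class of `0` contains no positive bead and, `g` being
odd, there is no class of `g / 2`, so no correction term occurs. -/
theorem card_and_prod_cells_doubledDistinct (τ : ℤ → Fˣ) (hgt : g = 2 * t + 1)
    (hdd : μ.IsDoubledDistinct) (hcore : μ.IsCore g) (hv : μ.IsVCoding g t v) :
    (μ.card : ℚ) = 1 / (g : ℚ) * ∑ i, ((v i : ℚ) - (g : ℚ) / 2) ^ 2
          - ((g : ℚ) - 2) * ((g / 2 : ℕ) : ℚ) / 12 ∧
      ∏ s ∈ μ.cells, τ ((μ.hookLength s : ℤ) - boxSign s * g) / τ (μ.hookLength s)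
        = (∏ i ∈ Icc 1 (g - 1), (τ (-(i : ℤ)) / τ i) ^ μ.signedHookCount g i) *
          ∏ i : Fin t, ∏ j ∈ Ioi i,
            (τ (v i - v j) / τ ((j : ℕ) - (i : ℕ) : ℤ)) *
            (τ (v i + v j - g) / τ ((g : ℤ) - ((i : ℕ) + 1) - ((j : ℕ) + 1))) := by
  obtain ⟨ht, β, σ, hβ, hσ, hvβ⟩ := hv
  have hμ := hdd.isShiftSymmetric
  have hg : 1 ≤ g := by omega
  have hends : IsChainEnds μ 0 0 (fun i => β i + (0 : ℕ)) :=
    isChainEnds_of_isClassEnd hμ hg (fun i => isClassEnd_of_isGreatest 0 (hβ i))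
      (fun i hi => by omega) (by omega) (fun i _ _ => hcore.isInitialClass _)
  have hstd : ∀ c : ℤ, (1 ≤ c ∧ c ≤ g - 1 + (0 : ℕ) ∧ (g : ℤ) < 2 * c + (0 : ℕ)) ↔
      (g - t + (0 : ℕ) ≤ c ∧ c ≤ g - 1 + (0 : ℕ)) := fun c => by omega
  have hσ' : StrictAnti fun j => β (σ j) + ((0 : ℕ) : ℤ) := by simpa using hσ
  constructor
  · rw [hends.card_eq hμ zero_le_one hg ht hstd σ hσ' (w := v) (fun j => by simp [hvβ]), mul_sub]
    congr 1
    have h1 : ∀ i : Fin t, (g : ℚ) - 1 + (0 : ℕ) - (i : ℕ) - g / 2 = (g / 2 - 1) - (i : ℕ) :=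
      fun i => by push_cast; ring
    rw [sum_congr rfl fun i _ => by rw [h1 i], sum_fin_sub_sq, show g / 2 = t by omega, hgt]
    push_cast
    field_simp
    ring
  · have key := hends.prod_cells hμ zero_le_one hg ht hstd σ hσ' (w := v)
      (fun j => by simp [hvβ]) τ (fun _ => 1) (fun _ => rfl) (fun f ψ _ hψ x => by
        rw [sum_endStep_standard f hg zero_le_one le_rfl, if_pos rfl, if_pos rfl,
          sum_half_of_odd _ ⟨t, hgt⟩, hψ, hψ]
        simp)
    rw [key]
    simp

/-- The first family of conjugates: the class of `0` contributes an end, and `g` is odd, so no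
correction term occurs. -/
theorem card_and_prod_cells_ddPrimeOne_odd (τ : ℤ → Fˣ) (hgt : g + 1 = 2 * t)
    (h : μ.IsDDPrimeOne g) (hv : μ.IsVCoding g t v) :
    (μ.card : ℚ) = 1 / (g : ℚ) * ∑ i, ((v i : ℚ) - (g : ℚ) / 2 + 1) ^ 2
          - ((g : ℚ) + 2) * (((g / 2 : ℕ) : ℚ) + 1) / 12 ∧
      ∏ s ∈ μ.cells, τ ((μ.hookLength s : ℤ) - boxSign s * g) / τ (μ.hookLength s)
        = (∏ i ∈ Icc 1 (g - 1), (τ (-(i : ℤ)) / τ i) ^ μ.signedHookCount g i) *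
          ∏ i : Fin t, ∏ j ∈ Ioi i,
            (τ (v i - v j) / τ ((j : ℕ) - (i : ℕ) : ℤ)) *
            (τ (v i + v j - g + 2) / τ ((g : ℤ) + 2 - ((i : ℕ) + 1) - ((j : ℕ) + 1))) := by
  obtain ⟨ht, β, σ, hβ, hσ, hvβ⟩ := hv
  have hμ := isShiftSymmetric_one_of_transpose h.1
  have hg : 1 ≤ g := by omega
  have hends : IsChainEnds μ 1 0 (fun i => β i + (1 : ℕ)) :=
    h.isChainEnds hg fun i => isClassEnd_of_isGreatest 1 (hβ i)
  have hstd : ∀ c : ℤ, (1 ≤ c ∧ c ≤ g - 1 + (1 : ℕ) ∧ (g : ℤ) < 2 * c + (0 : ℕ)) ↔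
      (g - t + (1 : ℕ) ≤ c ∧ c ≤ g - 1 + (1 : ℕ)) := fun c => by omega
  have hσ' : StrictAnti fun j => β (σ j) + ((1 : ℕ) : ℤ) := hσ.add_const _
  constructor
  · rw [hends.card_eq hμ zero_le_one hg ht hstd σ hσ' (w := fun j => v j + (1 : ℕ))
      (fun j => by simp [hvβ]), mul_sub]
    have h1 : ∀ i : Fin t, (g : ℚ) - 1 + (1 : ℕ) - (i : ℕ) - g / 2 = g / 2 - (i : ℕ) :=
      fun i => by push_cast; ring
    have h2 : ∀ i : Fin t, (((v i + (1 : ℕ) : ℤ) : ℚ)) - g / 2 = v i - g / 2 + 1 :=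
      fun i => by push_cast; ring
    have h3 : (g : ℚ) = 2 * t - 1 := by rw [eq_sub_iff_add_eq]; exact_mod_cast hgt
    have h4 : ((g / 2 : ℕ) : ℚ) = t - 1 := by
      rw [eq_sub_iff_add_eq]; exact_mod_cast (by omega : g / 2 + 1 = t)
    have h5 : (g : ℚ) ≠ 0 := by positivity
    simp only [h1, h2]
    rw [sum_fin_sub_sq, h4]
    congr 1
    rw [div_mul_eq_mul_div, one_mul, div_eq_iff h5, h3]
    ring
  · have key := hends.prod_cells hμ zero_le_one hg ht hstd σ hσ' (w := fun j => v j + (1 : ℕ))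
      (fun j => by simp [hvβ]) τ (fun _ => 1) (fun _ => rfl) (fun f ψ _ hψ x => by
        rw [sum_endStep_standard f hg le_rfl zero_le_one, if_neg one_ne_zero, if_pos rfl,
          sum_half_of_odd _ ⟨t - 1, by omega⟩, hψ, hψ]
        simp)
    rw [key, prod_eq_one (s := univ) (f := fun _ => (1 : Fˣ) / 1) (fun _ _ => div_one 1), mul_one]
    congr 1
    refine prod_congr rfl fun i _ => prod_congr rfl fun j _ => ?_
    rw [add_sub_add_right_eq_sub, Nat.cast_one, mul_one,
      show v i + (1 : ℤ) + (v j + 1) - g = v i + v j - g + 2 by ring]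

/-- The second family of conjugates: the class of `g / 2` has its end at `g / 2` and is left out of
the coding, which produces the factors `τ (r_i)`. -/
theorem card_and_prod_cells_ddPrimeOne_even (τ : ℤ → Fˣ) (ht1 : 1 ≤ t) (hgt : g = 2 * t)
    (h : μ.IsDDPrimeOne g) (hv : μ.IsVCoding g t v) :
    (μ.card : ℚ) = 1 / (g : ℚ) * ∑ i, ((v i : ℚ) - (g : ℚ) / 2 + 1) ^ 2
          - ((g : ℚ) + 1) * ((g : ℚ) / 2 + 1) / 12 ∧
      ∏ s ∈ μ.cells, τ ((μ.hookLength s : ℤ) - boxSign s * g) / τ (μ.hookLength s)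
        = (∏ i ∈ Icc 1 (g - 1), (τ (-(i : ℤ)) / τ i) ^ μ.signedHookCount g i) *
          (∏ i : Fin t, τ (v i - t + 1) / τ ((i : ℕ) + 1)) *
          ∏ i : Fin t, ∏ j ∈ Ioi i,
            (τ (v i - v j) / τ ((j : ℕ) - (i : ℕ) : ℤ)) *
            (τ (v i + v j - g + 2) / τ ((g : ℤ) + 2 - ((i : ℕ) + 1) - ((j : ℕ) + 1))) := by
  obtain ⟨ht, β, σ, hβ, hσ, hvβ⟩ := hv
  have hμ := isShiftSymmetric_one_of_transpose h.1
  have hg : 1 ≤ g := by omega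
  have hends : IsChainEnds μ 1 0 (fun i => β i + (1 : ℕ)) :=
    h.isChainEnds hg fun i => isClassEnd_of_isGreatest 1 (hβ i)
  have hstd : ∀ c : ℤ, (1 ≤ c ∧ c ≤ g - 1 + (1 : ℕ) ∧ (g : ℤ) < 2 * c + (0 : ℕ)) ↔
      (g - t + (1 : ℕ) ≤ c ∧ c ≤ g - 1 + (1 : ℕ)) := fun c => by omega
  have hσ' : StrictAnti fun j => β (σ j) + ((1 : ℕ) : ℤ) := hσ.add_const _
  have hw : ∀ j, v j + ((1 : ℕ) : ℤ) = β (σ (Fin.castLE ht j)) + (1 : ℕ) := fun j => by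
    rw [hvβ]
  constructor
  · rw [hends.card_eq hμ zero_le_one hg ht hstd σ hσ' hw, mul_sub]
    have h1 : ∀ i : Fin t, (g : ℚ) - 1 + (1 : ℕ) - (i : ℕ) - g / 2 = g / 2 - (i : ℕ) :=
      fun i => by push_cast; ring
    have h2 : ∀ i : Fin t, (((v i + (1 : ℕ) : ℤ) : ℚ)) - g / 2 = v i - g / 2 + 1 :=
      fun i => by push_cast; ring
    have h3 : (g : ℚ) = 2 * t := by exact_mod_cast hgt
    have h5 : (g : ℚ) ≠ 0 := by positivity
    simp only [h1, h2]
    rw [sum_fin_sub_sq]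
    congr 1
    rw [div_mul_eq_mul_div, one_mul, div_eq_iff h5, h3]
    ring
  · have key := hends.prod_cells hμ zero_le_one hg ht hstd σ hσ' hw τ (fun c => τ |c - t|)
      (fun c => by rw [hgt, ← abs_neg]; congr 2; push_cast; ring) (fun f ψ hf hψ x => by
        have hψf : ∀ c, ψ c = f (c - t) := fun c => by rw [hψ, hf]
        rw [sum_endStep_standard f hg le_rfl zero_le_one, if_neg one_ne_zero, if_pos rfl,
          sum_half_of_even _ ht1 hgt, hψf, hψf, hgt, sub_eq_add_neg]
        congr 4
        push_cast; ring)
    have hpos : ∀ i, (0 : ℤ) ≤ v i + (1 : ℕ) - t := fun i => by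
      have := hends.lt_two_mul hμ zero_le_one hstd σ hσ' ht i
      rw [← hw] at this
      omega
    have hrev : ∏ i : Fin t, τ |(g : ℤ) - 1 + (1 : ℕ) - (i : ℕ) - t| =
        ∏ i : Fin t, τ ((i : ℕ) + 1) := by
      rw [← Equiv.prod_comp Fin.revPerm]
      refine prod_congr rfl fun i _ => ?_
      have := i.2
      rw [Fin.revPerm_apply, Fin.val_rev]
      congr 1
      rw [abs_of_nonneg (by omega)]
      omega
    rw [key, prod_div_distrib, hrev, ← prod_div_distrib]
    congr 1
    · congr 1
      refine prod_congr rfl fun i _ => ?_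
      rw [abs_of_nonneg (hpos i)]
      congr 2
      push_cast; ring
    refine prod_congr rfl fun i _ => prod_congr rfl fun j _ => ?_
    rw [add_sub_add_right_eq_sub, Nat.cast_one, mul_one,
      show v i + (1 : ℤ) + (v j + 1) - g = v i + v j - g + 2 by ring]

/-- The third family of conjugates: the class of `g / 2` is one of the chains, although it is its
own reflection, which produces the factors `τ (r_i)⁻¹`. -/
theorem card_and_prod_cells_ddPrimeTwo (τ : ℤ → Fˣ) (ht2 : 2 ≤ t) (hgt : g + 2 = 2 * t)
    (h : μ.IsDDPrimeTwo g) (hv : μ.IsVCoding g t v) :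
    (μ.card : ℚ) = 1 / (g : ℚ) * ∑ i, ((v i : ℚ) - (g : ℚ) / 2 + 1) ^ 2
          - ((g : ℚ) / 2 + 1) * ((g : ℚ) + 1) / 12 ∧
      ∏ s ∈ μ.cells, τ ((μ.hookLength s : ℤ) - boxSign s * g) / τ (μ.hookLength s)
        = (∏ i ∈ Icc 1 (g - 1), (τ (-(i : ℤ)) / τ i) ^ μ.signedHookCount g i) *
          (∏ i : Fin t, τ ((t : ℤ) - ((i : ℕ) + 1)) / τ (v i - t + 2)) *
          ∏ i : Fin t, ∏ j ∈ Ioi i,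
            (τ (v i - v j) / τ ((j : ℕ) - (i : ℕ) : ℤ)) *
            (τ (v i + v j - g + 2) / τ ((g : ℤ) + 2 - ((i : ℕ) + 1) - ((j : ℕ) + 1))) := by
  obtain ⟨ht, β, σ, hβ, hσ, hvβ⟩ := hv
  have hμ := isShiftSymmetric_one_of_transpose h.1
  have hg : 1 ≤ g := by omega
  have hends : IsChainEnds μ 1 1 (fun i => β i + (1 : ℕ)) :=
    h.isChainEnds hg fun i => isClassEnd_of_isGreatest 1 (hβ i)
  have hstd : ∀ c : ℤ, (1 ≤ c ∧ c ≤ g - 1 + (1 : ℕ) ∧ (g : ℤ) < 2 * c + (1 : ℕ)) ↔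
      (g - t + (1 : ℕ) ≤ c ∧ c ≤ g - 1 + (1 : ℕ)) := fun c => by omega
  have hσ' : StrictAnti fun j => β (σ j) + ((1 : ℕ) : ℤ) := hσ.add_const _
  have hw : ∀ j, v j + ((1 : ℕ) : ℤ) = β (σ (Fin.castLE ht j)) + (1 : ℕ) := fun j => by
    rw [hvβ]
  constructor
  · rw [hends.card_eq hμ le_rfl hg ht hstd σ hσ' hw, mul_sub]
    have h1 : ∀ i : Fin t, (g : ℚ) - 1 + (1 : ℕ) - (i : ℕ) - g / 2 = g / 2 - (i : ℕ) :=
      fun i => by push_cast; ring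
    have h2 : ∀ i : Fin t, (((v i + (1 : ℕ) : ℤ) : ℚ)) - g / 2 = v i - g / 2 + 1 :=
      fun i => by push_cast; ring
    have h3 : (g : ℚ) = 2 * t - 2 := by rw [eq_sub_iff_add_eq]; exact_mod_cast hgt
    have h5 : (g : ℚ) ≠ 0 := by positivity
    simp only [h1, h2]
    rw [sum_fin_sub_sq]
    congr 1
    rw [div_mul_eq_mul_div, one_mul, div_eq_iff h5, h3]
    ring
  · have hg2 : g = 2 * (t - 1) := by omega
    have key := hends.prod_cells hμ le_rfl hg ht hstd σ hσ' hw τ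
      (fun c => (τ |c - (t - 1 : ℕ)|)⁻¹)
      (fun c => by rw [hg2, ← abs_neg]; congr 3; push_cast; ring) (fun f ψ hf hψ x => by
        have hψf : ∀ c, ψ c = -f (c - (t - 1 : ℕ)) := fun c => by rw [hψ, hf, ofMul_inv]
        rw [sum_endStep_standard f hg le_rfl le_rfl, if_neg one_ne_zero, if_neg one_ne_zero,
          sum_half_of_even _ (by omega) hg2, hψf, hψf,
          show x + (g : ℤ) - (t - 1 : ℕ) = x + (t - 1 : ℕ) by omega]
        abel)
    have hpos : ∀ i, (0 : ℤ) ≤ v i + (1 : ℕ) - (t - 1 : ℕ) := fun i => by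
      have := hends.lt_two_mul hμ le_rfl hstd σ hσ' ht i
      rw [← hw] at this
      omega
    rw [key]
    congr 1
    · congr 1
      refine prod_congr rfl fun i _ => ?_
      have := i.2
      rw [abs_of_nonneg (hpos i), abs_of_nonneg (by omega), inv_div_inv]
      congr 2 <;> omega
    refine prod_congr rfl fun i _ => prod_congr rfl fun j _ => ?_
    rw [add_sub_add_right_eq_sub, Nat.cast_one, mul_one,
      show v i + (1 : ℤ) + (v j + 1) - g = v i + v j - g + 2 by ring]

end Cases

end YoungDiagram

theorem mainTheorem12 {F : Type*} [Field F] (τ : ℤ → Fˣ) (t : ℕ) (ht : 1 ≤ t)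
    (μ : YoungDiagram) (v : Fin t → ℤ) :
    -- Doubled distinct `g`-cores, `g = 2t + 1`, with `r_i = v_i - g/2`.
    (∀ g : ℕ, g = 2 * t + 1 → μ.IsDoubledDistinct → μ.IsCore g → μ.IsVCoding g t v →
      (μ.card : ℚ) = 1 / (g : ℚ) * ∑ i, ((v i : ℚ) - (g : ℚ) / 2) ^ 2
          - ((g : ℚ) - 2) * ((g / 2 : ℕ) : ℚ) / 12 ∧
      ∏ s ∈ μ.cells, τ ((μ.hookLength s : ℤ) - YoungDiagram.boxSign s * g) / τ (μ.hookLength s)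
        = (∏ i ∈ Finset.Icc 1 (g - 1), (τ (-(i : ℤ)) / τ i) ^ μ.signedHookCount g i) *
          ∏ i : Fin t, ∏ j ∈ Finset.Ioi i,
            (τ (v i - v j) / τ ((j : ℕ) - (i : ℕ) : ℤ)) *
            (τ (v i + v j - g) / τ ((g : ℤ) - ((i : ℕ) + 1) - ((j : ℕ) + 1)))) ∧
    -- The first companion, `g = 2t - 1`, with `r_i = v_i - g/2 + 1`.
    (∀ g : ℕ, g + 1 = 2 * t → μ.IsDDPrimeOne g → μ.IsVCoding g t v →
      (μ.card : ℚ) = 1 / (g : ℚ) * ∑ i, ((v i : ℚ) - (g : ℚ) / 2 + 1) ^ 2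
          - ((g : ℚ) + 2) * (((g / 2 : ℕ) : ℚ) + 1) / 12 ∧
      ∏ s ∈ μ.cells, τ ((μ.hookLength s : ℤ) - YoungDiagram.boxSign s * g) / τ (μ.hookLength s)
        = (∏ i ∈ Finset.Icc 1 (g - 1), (τ (-(i : ℤ)) / τ i) ^ μ.signedHookCount g i) *
          ∏ i : Fin t, ∏ j ∈ Finset.Ioi i,
            (τ (v i - v j) / τ ((j : ℕ) - (i : ℕ) : ℤ)) *
            (τ (v i + v j - g + 2) / τ ((g : ℤ) + 2 - ((i : ℕ) + 1) - ((j : ℕ) + 1)))) ∧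
    -- The second companion, `g = 2t`, with `r_i = v_i - g/2 + 1 = v_i - t + 1`.
    (∀ g : ℕ, g = 2 * t → μ.IsDDPrimeOne g → μ.IsVCoding g t v →
      (μ.card : ℚ) = 1 / (g : ℚ) * ∑ i, ((v i : ℚ) - (g : ℚ) / 2 + 1) ^ 2
          - ((g : ℚ) + 1) * ((g : ℚ) / 2 + 1) / 12 ∧
      ∏ s ∈ μ.cells, τ ((μ.hookLength s : ℤ) - YoungDiagram.boxSign s * g) / τ (μ.hookLength s)
        = (∏ i ∈ Finset.Icc 1 (g - 1), (τ (-(i : ℤ)) / τ i) ^ μ.signedHookCount g i) *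
          (∏ i : Fin t, τ (v i - t + 1) / τ ((i : ℕ) + 1)) *
          ∏ i : Fin t, ∏ j ∈ Finset.Ioi i,
            (τ (v i - v j) / τ ((j : ℕ) - (i : ℕ) : ℤ)) *
            (τ (v i + v j - g + 2) / τ ((g : ℤ) + 2 - ((i : ℕ) + 1) - ((j : ℕ) + 1)))) ∧
    -- The third companion, `g = 2t - 2` and `t ≥ 2`, with `r_i = v_i - g/2 + 1 = v_i - t + 2`.
    (∀ g : ℕ, 2 ≤ t → g + 2 = 2 * t → μ.IsDDPrimeTwo g → μ.IsVCoding g t v →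
      (μ.card : ℚ) = 1 / (g : ℚ) * ∑ i, ((v i : ℚ) - (g : ℚ) / 2 + 1) ^ 2
          - ((g : ℚ) / 2 + 1) * ((g : ℚ) + 1) / 12 ∧
      ∏ s ∈ μ.cells, τ ((μ.hookLength s : ℤ) - YoungDiagram.boxSign s * g) / τ (μ.hookLength s)
        = (∏ i ∈ Finset.Icc 1 (g - 1), (τ (-(i : ℤ)) / τ i) ^ μ.signedHookCount g i) *
          (∏ i : Fin t, τ ((t : ℤ) - ((i : ℕ) + 1)) / τ (v i - t + 2)) *
          ∏ i : Fin t, ∏ j ∈ Finset.Ioi i,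
            (τ (v i - v j) / τ ((j : ℕ) - (i : ℕ) : ℤ)) *
            (τ (v i + v j - g + 2) / τ ((g : ℤ) + 2 - ((i : ℕ) + 1) - ((j : ℕ) + 1)))) :=
  ⟨fun _ hg hdd hcore hv => YoungDiagram.card_and_prod_cells_doubledDistinct τ hg hdd hcore hv,
    fun _ hg h hv => YoungDiagram.card_and_prod_cells_ddPrimeOne_odd τ hg h hv,
    fun _ hg h hv => YoungDiagram.card_and_prod_cells_ddPrimeOne_even τ ht hg h hv,
    fun _ ht2 hg h hv => YoungDiagram.card_and_prod_cells_ddPrimeTwo τ ht2 hg h hv⟩
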